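/- There is an absolute constant $C$ with the following property. Let $p$ be a prime, $\mathbb{F}=\mathbb{F}_p$, and let $n,r\ge 0$ be integers. Polynomials over $\mathbb{F}$ in $n$ variables are identified with the functions $\mathbb{F}^n\to\mathbb{F}$ that they define; a function has degree at most $d$ if it equals, as a function, a polynomial of total degree at most $d$, and functions of degree at most $1$, $2$, $3$ are called linear, quadratic and cubic, respectively. For a cubic function $g$ let $\mathrm{rank}_3(g)$ be the minimal integer $s$ such that $g=\sum_{i=1}^{s}\ell_i q_i+q_0$ for some linear functions $\ell_1,\dots,\ell_s$ and quadratic functions $q_0,\dots,q_s$. Let $M$ be an $\mathbb{F}$-linear space of cubic functions on $\mathbb{F}^n$ such that $\mathrm{rank}_3(f)\le r$ for all $f\in M$. Then there exist quadratic functions $Q_1,\dots,Q_{t_1}$ and linear functions $\ell_1,\dots,\ell_{t_2}$, with $t_1\le r$ and $t_2\le 2^{Cr}$, such that every $f\in M$ can be represented as $$f=\sum_{i=1}^{t_1}\ell_i^f\,Q_i+\sum_{i=1}^{t_2}\ell_i\,Q_i^f+Q_0^f$$ for some linear functions $\ell_1^f,\dots,\ell_{t_1}^f$ and quadratic functions $Q_0^f,\dots,Q_{t_2}^f$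 depending on $f$. -/

import Mathlib

/-- `f : 𝔽_p^n → 𝔽_p` has degree at most `d`: it equals, as a function, some polynomial of total
degree at most `d`. Degree at most `1`, `2`, `3` are the "linear", "quadratic" and "cubic"
functions (lower order terms, including constants, are allowed). -/
def HasDegreeLE {p n : ℕ} (d : ℕ) (f : (Fin n → ZMod p) → ZMod p) : Prop :=
  ∃ P : MvPolynomial (Fin n) (ZMod p), P.totalDegree ≤ d ∧ ∀ x, MvPolynomial.eval x P = f x

/-- `g = ∑_{i < s} ℓ_i q_i + q_0` for some linear functions `ℓ_i` and quadratic functions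
`q_i`, `q_0`. -/
def HasCubicRep {p n : ℕ} (s : ℕ) (g : (Fin n → ZMod p) → ZMod p) : Prop :=
  ∃ (l q : Fin s → (Fin n → ZMod p) → ZMod p) (q₀ : (Fin n → ZMod p) → ZMod p),
    (∀ i, HasDegreeLE 1 (l i)) ∧ (∀ i, HasDegreeLE 2 (q i)) ∧ HasDegreeLE 2 q₀ ∧
      g = ∑ i, l i * q i + q₀

/-- `rank₃(g)`: the minimal `s` such that `g = ∑_{i < s} ℓ_i q_i + q_0` with `ℓ_i` linear and
`q_i`, `q_0` quadratic. The minimum is over a non-empty set when `g` has degree at most three,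
by `exists_hasCubicRep` below. -/
noncomputable def rank₃ {p n : ℕ} (g : (Fin n → ZMod p) → ZMod p) : ℕ :=
  sInf {s | HasCubicRep s g}

theorem HasCubicRep.add {p n s t : ℕ} {f g : (Fin n → ZMod p) → ZMod p}
    (hf : HasCubicRep s f) (hg : HasCubicRep t g) : HasCubicRep (s + t) (f + g) := by
  obtain ⟨l, q, q₀, hl, hq, ⟨P, hP, hPe⟩, rfl⟩ := hf
  obtain ⟨l', q', q₀', hl', hq', ⟨P', hP', hPe'⟩, rfl⟩ := hg
  refine ⟨Fin.append l l', Fin.append q q', q₀ + q₀', ?_, ?_, ⟨P + P', ?_, ?_⟩, ?_⟩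
  · intro i
    refine Fin.addCases (fun i => ?_) (fun i => ?_) i
    · simpa using hl i
    · simpa using hl' i
  · intro i
    refine Fin.addCases (fun i => ?_) (fun i => ?_) i
    · simpa using hq i
    · simpa using hq' i
  · exact (MvPolynomial.totalDegree_add _ _).trans (max_le hP hP')
  · intro x
    simp [hPe, hPe']
  · rw [Fin.sum_univ_add]
    simp only [Fin.append_left, Fin.append_right]
    abel

theorem exists_hasCubicRep {p n : ℕ} {f : (Fin n → ZMod p) → ZMod p}
    (hf : HasDegreeLE 3 f) : ∃ s, HasCubicRep s f := by
  obtain ⟨P, hP, hPe⟩ := hf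
  have key : ∀ T : Finset (Fin n →₀ ℕ), T ⊆ P.support → ∃ s, HasCubicRep s
      (fun x => MvPolynomial.eval x (∑ m ∈ T, MvPolynomial.monomial m (P.coeff m))) := by
    intro T
    induction T using Finset.induction_on with
    | empty =>
      intro _
      exact ⟨0, Fin.elim0, Fin.elim0, 0, fun i => i.elim0, fun i => i.elim0,
        ⟨0, by simp, by simp⟩, by ext; simp⟩
    | insert m T hm ih =>
      intro hT
      obtain ⟨t, ht⟩ := ih ((Finset.subset_insert m T).trans hT)
      have hdeg : (m.sum fun _ e => e) ≤ 3 :=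
        (MvPolynomial.le_totalDegree (hT (Finset.mem_insert_self m T))).trans hP
      have h1 : ∃ s, HasCubicRep s
          (fun x => MvPolynomial.eval x (MvPolynomial.monomial m (P.coeff m))) := by
        by_cases h2 : (m.sum fun _ e => e) ≤ 2
        · exact ⟨0, Fin.elim0, Fin.elim0, _, fun i => i.elim0, fun i => i.elim0,
            ⟨MvPolynomial.monomial m (P.coeff m),
              (MvPolynomial.totalDegree_monomial_le _ _).trans h2, fun x => rfl⟩,
            by ext; simp⟩
        · have hm0 : m ≠ 0 := by
            rintro rfl
            simp at h2
          obtain ⟨i, hi⟩ := Finsupp.ne_iff.mp hm0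
          have hle : Finsupp.single i 1 ≤ m := by
            rw [Finsupp.single_le_iff]
            exact Nat.one_le_iff_ne_zero.mpr (by simpa using hi)
          obtain ⟨m', rfl⟩ := exists_add_of_le hle
          refine ⟨1, fun _ x => x i, fun _ x => MvPolynomial.eval x
            (MvPolynomial.monomial m' (P.coeff (Finsupp.single i 1 + m'))), 0,
            fun _ => ⟨MvPolynomial.monomial (Finsupp.single i 1) 1, ?_, ?_⟩,
            fun _ => ⟨_, ?_, fun x => rfl⟩, ⟨0, by simp, by simp⟩, ?_⟩
          · exact (MvPolynomial.totalDegree_monomial_le _ _).trans (by simp)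
          · intro x
            simp [MvPolynomial.eval_monomial]
          · refine (MvPolynomial.totalDegree_monomial_le _ _).trans ?_
            rw [Finsupp.sum_add_index' (by simp) (by simp)] at hdeg
            simp only [Finsupp.sum_single_index] at hdeg
            change (m'.sum fun _ e => e) ≤ 2
            omega
          · ext x
            have : MvPolynomial.monomial (Finsupp.single i 1 + m')
                (P.coeff (Finsupp.single i 1 + m')) = MvPolynomial.X i *
                MvPolynomial.monomial m' (P.coeff (Finsupp.single i 1 + m')) := by
              rw [MvPolynomial.X, MvPolynomial.monomial_mul, one_mul]
            rw [this]
            simp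
      obtain ⟨s, hs⟩ := h1
      refine ⟨s + t, ?_⟩
      have := hs.add ht
      convert this using 1
      ext x
      simp [Finset.sum_insert hm]
  obtain ⟨s, hs⟩ := key P.support subset_rfl
  refine ⟨s, ?_⟩
  rw [← MvPolynomial.as_sum] at hs
  convert hs using 1
  ext x
  exact (hPe x).symm

/-! Third differences at the origin send `f` in `M` to a symmetric trilinear form `Φ f`, and rank at
most `r` makes `Φ f` vanish on a subspace `K` of codimension at most `r`. For `x` in `K` the
bilinear form `Φ f x` has rank at most `2r`, so `x ↦ Φ f x` is a linear map of rank at most `r`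
modulo low-rank forms. The problem becomes one about linear spaces of such maps.

A dichotomy (`exists_covers`) puts all values `Φ f x`, for `x` in a subspace of bounded codimension,
into a fixed space `W` of dimension polynomial in `r`, up to errors of rank `2^O(r)`. Shrinking `W`
and the domain until no nonzero element of `W` has low rank (`exists_regular`) makes the approximant
unique, hence bilinear in `f` and `x` and of rank at most `r` exactly. Counting functionals over the
finite field (`exists_compression`) then cuts `W` down to dimension at most `r`. This yields forms
`w i`, at most `r` in number, with `Φ f x` close to `∑ i, l i f x • w i`.

Subtracting the symmetrization of this sum leaves forms that still vanish on `K` inside the new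
domain and have all derivatives of low rank. Such a family vanishes on a common subspace `U` of
bounded codimension (`exists_vanishing`).

Each `w i` is the second difference of a quadratic `Q i`, a combination of derivatives of elements
of `M`. The third difference of `l * Q` is exactly the symmetrization of `l ⊗ w` (`d3_linear_mul`),
so no division is needed and small primes cause no trouble. The third difference of `f - ∑ l_i Q_i`
vanishes on `U`, which places it, modulo quadratics, in the ideal of the linear forms vanishing on
`U` (`exists_rep_of_d3_eq_zero_on`). -/

namespace CubicSpace

open Module Submodule

/-! ### Codimension of subspaces. -/

section LinearAlgebra

variable {F V W : Type*} [Field F] [AddCommGroup V] [Module F V] [FiniteDimensional F V]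
  [AddCommGroup W] [Module F W]

/-- The codimension of a subspace. -/
noncomputable def codim (K : Submodule F V) : ℕ := finrank F (V ⧸ K)

theorem codim_add_finrank (K : Submodule F V) : codim K + finrank F K = finrank F V :=
  Submodule.finrank_quotient_add_finrank K

theorem codim_top : codim (⊤ : Submodule F V) = 0 := by
  have := codim_add_finrank (⊤ : Submodule F V)
  rw [finrank_top] at this
  omega

theorem codim_inf_le (K L : Submodule F V) : codim (K ⊓ L) ≤ codim K + codim L := by
  have h1 := Submodule.finrank_sup_add_finrank_inf_eq K L
  have h2 := Submodule.finrank_le (K ⊔ L)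
  have := codim_add_finrank K
  have := codim_add_finrank L
  have := codim_add_finrank (K ⊓ L)
  omega

theorem codim_ker_le [FiniteDimensional F W] (g : V →ₗ[F] W) :
    codim (LinearMap.ker g) ≤ finrank F W := by
  have h1 := LinearMap.finrank_range_add_finrank_ker g
  have h2 := Submodule.finrank_le (LinearMap.range g)
  have := codim_add_finrank (LinearMap.ker g)
  omega

/-- The common kernel of `d` functionals has codimension at most `d`. -/
theorem exists_codim_le_of_functionals {d : ℕ} (g : Fin d → V →ₗ[F] F) :
    ∃ K : Submodule F V, codim K ≤ d ∧ ∀ x ∈ K, ∀ i, g i x = 0 := by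
  refine ⟨LinearMap.ker (LinearMap.pi g), ?_, fun x hx i => ?_⟩
  · simpa using codim_ker_le (LinearMap.pi g)
  · exact congrFun (LinearMap.mem_ker.1 hx) i

theorem exists_iInf_codim_le {ι : Type*} (s : Finset ι) (K : ι → Submodule F V) {R : ℕ}
    (h : ∀ i ∈ s, codim (K i) ≤ R) :
    ∃ L : Submodule F V, codim L ≤ s.card * R ∧ ∀ i ∈ s, L ≤ K i := by
  classical
  induction s using Finset.induction_on with
  | empty => exact ⟨⊤, by simp [codim_top], by simp⟩
  | insert a s ha ih =>
    obtain ⟨L, hL, hLK⟩ := ih fun i hi => h i (Finset.mem_insert_of_mem hi)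
    refine ⟨K a ⊓ L, ?_, ?_⟩
    · have := codim_inf_le (K a) L
      have := h a (Finset.mem_insert_self a s)
      rw [Finset.card_insert_of_notMem ha, add_mul]
      omega
    · intro i hi
      rcases Finset.mem_insert.1 hi with rfl | hi
      · exact inf_le_left
      · exact inf_le_right.trans (hLK i hi)

/-- A subspace `U` is spanned modulo `K` by at most `codim K` of its elements. -/
theorem exists_spanning_mod (K U : Submodule F V) :
    ∃ (d : ℕ) (e : Fin d → V), d ≤ codim K ∧ (∀ i, e i ∈ U) ∧
      ∀ x ∈ U, ∃ c : Fin d → F, x - ∑ i, c i • e i ∈ K := by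
  set R := U.map K.mkQ
  have he : ∀ i, ∃ e ∈ U, K.mkQ e = (finBasis F R i : V ⧸ K) := fun i =>
    Submodule.mem_map.1 (finBasis F R i).2
  choose e heU he using he
  refine ⟨finrank F R, e, Submodule.finrank_le R, heU, fun x hx => ?_⟩
  have hxR : K.mkQ x ∈ R := Submodule.mem_map_of_mem hx
  refine ⟨(finBasis F R).repr ⟨_, hxR⟩, ?_⟩
  rw [← Submodule.Quotient.mk_eq_zero, ← Submodule.mkQ_apply, map_sub, map_sum, sub_eq_zero]
  have := congrArg (Subtype.val) ((finBasis F R).sum_repr ⟨_, hxR⟩)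
  simp only [Submodule.coe_sum, Submodule.coe_smul] at this
  simp only [map_smul, he]
  exact this.symm

end LinearAlgebra

/-! ### The cover-or-expand dichotomy modulo a filtration. -/

section Cover

variable {F M X Y : Type*} [Field F] [AddCommGroup M] [Module F M] [AddCommGroup X] [Module F X]
  [FiniteDimensional F X] [AddCommGroup Y] [Module F Y]

/-- An increasing filtration of a vector space by scaling invariant sets that is compatible with
addition. -/
structure IsFiltration (F : Type*) {Y : Type*} [Field F] [AddCommGroup Y] [Module F Y]
    (N : ℕ → Set Y) : Prop where
  mono : Monotone N
  smul_mem : ∀ (c : F) {a y}, y ∈ N a → c • y ∈ N a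
  add_mem : ∀ {a b y z}, y ∈ N a → z ∈ N b → y + z ∈ N (a + b)
  zero_mem : 0 ∈ N 0

theorem IsFiltration.sub_mem {N : ℕ → Set Y} (hN : IsFiltration F N) {a b : ℕ} {y z : Y}
    (hy : y ∈ N a) (hz : z ∈ N b) : y - z ∈ N (a + b) := by
  have := hN.add_mem hy (hN.smul_mem (-1) hz)
  rwa [neg_one_smul, ← sub_eq_add_neg] at this

/-- Some `B` maps no nonzero vector of a `d`-dimensional subspace of `X' ⊓ U` into
`span s + N T`. -/
def Expands (Φ : M →ₗ[F] X →ₗ[F] Y) (U : Submodule F X) (N : ℕ → Set Y) (d T : ℕ)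
    (X' : Submodule F X) (s : Finset Y) : Prop :=
  ∃ (B : M) (Z : Submodule F X), finrank F Z = d ∧ Z ≤ X' ⊓ U ∧
    ∀ z ∈ Z, z ≠ 0 → ∀ y ∈ span F (s : Set Y), Φ B z - y ∉ N T

/-- Every `Φ m` maps `X' ⊓ U` into `span s + N T`. -/
def Covers (Φ : M →ₗ[F] X →ₗ[F] Y) (U : Submodule F X) (N : ℕ → Set Y) (T : ℕ)
    (X' : Submodule F X) (s : Finset Y) : Prop :=
  ∀ m, ∀ x ∈ X' ⊓ U, ∃ y ∈ span F (s : Set Y), Φ m x - y ∈ N T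

/-- Adjoin `x` to `Z`; then `B` or `B + m` expands on the larger space. Since `m` is small on `Z`,
both maps expand on `Z`, so any failures have the form `x + z` and `x + w`. Subtracting them
compares `B (z - w)` with `m (x + w)`, which contradicts the expansion of `B` modulo `s'` if `z ≠
w`, and the choice of `x` if `z = w`. -/
theorem Expands.succ {Φ : M →ₗ[F] X →ₗ[F] Y} {U : Submodule F X} {N : ℕ → Set Y}
    (hN : IsFiltration F N) {d t T T' : ℕ} {X' K : Submodule F X} {s s' : Finset Y} {m : M} {x : X}
    (hK : ∀ z ∈ K ⊓ U, Φ m z ∈ N t) (hs : s ⊆ s')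
    (hm : ∀ z ∈ U, ∃ y ∈ span F (s' : Set Y), Φ m z - y ∈ N t)
    (hx : x ∈ X' ⊓ U) (hxs : ∀ y ∈ span F (s : Set Y), Φ m x - y ∉ N T') (hT : 2 * T + t ≤ T')
    (h : Expands Φ U N d (2 * T + t) (X' ⊓ K) s') : Expands Φ U N (d + 1) T X' s := by
  obtain ⟨B, Z, hZd, hZ, hB⟩ := h
  have hss : span F (s : Set Y) ≤ span F (s' : Set Y) := span_mono (by exact_mod_cast hs)
  have hZK : ∀ z ∈ Z, Φ m z ∈ N t := fun z hz => hK z ⟨(hZ hz).1.2, (hZ hz).2⟩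
  have hZU : ∀ z ∈ Z, z ∈ U := fun z hz => (hZ hz).2
  have hxZ : x ∉ Z := fun hxZ => hxs 0 (zero_mem _) (by
    simpa using hN.mono (by omega : t ≤ T') (hZK x hxZ))
  have hrank : finrank F ↥(Z ⊔ span F {x}) = d + 1 := by
    have h1 := Submodule.finrank_sup_add_finrank_inf_eq Z (span F {x})
    have h2 : Z ⊓ span F {x} = ⊥ := by
      rw [eq_bot_iff]
      rintro z ⟨hz, hzx⟩
      obtain ⟨c, rfl⟩ := mem_span_singleton.1 hzx
      by_cases hc : c = 0
      · simp [hc]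
      · exact absurd ((Z.smul_mem_iff hc).1 hz) hxZ
    have hx0 : x ≠ 0 := fun h => hxZ (h ▸ zero_mem _)
    rw [h2, finrank_bot, finrank_span_singleton hx0] at h1
    omega
  have hle : Z ⊔ span F {x} ≤ X' ⊓ U := by
    refine sup_le (hZ.trans (inf_le_inf_right _ inf_le_left)) ?_
    rw [span_singleton_le_iff_mem]
    exact hx
  by_contra hcon
  have key : ∀ B' : M, ∃ z ∈ Z ⊔ span F {x}, z ≠ 0 ∧ ∃ y ∈ span F (s : Set Y),
      Φ B' z - y ∈ N T := by
    intro B'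
    by_contra! h
    exact hcon ⟨B', _, hrank, hle, h⟩
  -- A bad vector outside `Z` can be scaled so that its coefficient at `x` is one.
  have norm : ∀ B' : M, (∃ z ∈ Z, z ≠ 0 ∧ ∃ y ∈ span F (s : Set Y), Φ B' z - y ∈ N T) ∨
      ∃ z ∈ Z, ∃ y ∈ span F (s : Set Y), Φ B' (x + z) - y ∈ N T := by
    intro B'
    obtain ⟨z, hz, hz0, y, hy, hzy⟩ := key B'
    obtain ⟨z', hz', w, hw, rfl⟩ := mem_sup.1 hz
    obtain ⟨c, rfl⟩ := mem_span_singleton.1 hw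
    by_cases hc : c = 0
    · left
      subst hc
      rw [zero_smul, add_zero] at hz0 hzy
      exact ⟨z', hz', hz0, y, hy, hzy⟩
    · right
      refine ⟨c⁻¹ • z', Z.smul_mem _ hz', c⁻¹ • y, smul_mem _ _ hy, ?_⟩
      convert hN.smul_mem c⁻¹ hzy using 1
      rw [smul_sub, ← map_smul, smul_add, smul_smul, inv_mul_cancel₀ hc, one_smul, add_comm x]
  rcases norm B with ⟨z, hz, hz0, y, hy, hzy⟩ | ⟨z, hz, y, hy, hzy⟩
  · exact hB z hz hz0 y (hss hy) (hN.mono (by omega) hzy)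
  rcases norm (B + m) with ⟨w, hw, hw0, v, hv, hwv⟩ | ⟨w, hw, v, hv, hwv⟩
  · refine hB w hw hw0 v (hss hv) (hN.mono (by omega : T + t ≤ _) ?_)
    convert hN.sub_mem hwv (hZK w hw) using 1
    simp only [map_add, LinearMap.add_apply]
    abel
  have hsub := hN.sub_mem hzy hwv
  by_cases hzw : z = w
  · subst hzw
    refine hxs (v - y) (sub_mem hv hy) (hN.mono (by omega : T + T + t ≤ T') ?_)
    have := hN.smul_mem (-1) (hN.add_mem hsub (hZK z hz))
    convert this using 1
    simp only [map_add, LinearMap.add_apply, neg_smul, one_smul]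
    abel
  · obtain ⟨u, hu, hmu⟩ := hm (x + w) (add_mem hx.2 (hZU w hw))
    refine hB (z - w) (sub_mem hz hw) (sub_ne_zero.2 hzw) (y - v + u)
      (add_mem (sub_mem (hss hy) (hss hv)) hu) (hN.mono (by omega : T + T + t ≤ _) ?_)
    convert hN.add_mem hsub hmu using 1
    simp only [map_add, map_sub, LinearMap.add_apply]
    abel

/-- If covering fails at `(m, x)`, restrict to the near-kernel `K` of `m`, add to `s` generators of
the image of `m` modulo small elements, and recurse; `Expands.succ` lifts an expansion back. The
tolerance goes from `T` to `2 * T + t`, which doubles `T + t`: this is the source of `2 ^ d * (T +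
t)`. -/
theorem exists_covers_or_expands {Φ : M →ₗ[F] X →ₗ[F] Y} {U : Submodule F X} {N : ℕ → Set Y}
    (hN : IsFiltration F N) {r t : ℕ}
    (hΦ : ∀ m, ∃ K : Submodule F X, codim K ≤ r ∧ ∀ x ∈ K ⊓ U, Φ m x ∈ N t) (d : ℕ) :
    ∀ (T : ℕ) (X' : Submodule F X) (s : Finset Y),
      (∃ (X'' : Submodule F X) (s'' : Finset Y), codim X'' ≤ codim X' + d * r ∧
        s''.card ≤ s.card + d * r ∧ (∀ y ∈ s'', y ∈ s ∨ ∃ m, ∃ x ∈ U, y = Φ m x) ∧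
        Covers Φ U N (2 ^ d * (T + t)) X'' s'') ∨ Expands Φ U N d T X' s := by
  classical
  induction d with
  | zero =>
    intro T X' s
    right
    refine ⟨0, ⊥, by simp, bot_le, fun z hz hz0 => absurd ((mem_bot F).1 hz) hz0⟩
  | succ d ih =>
    intro T X' s
    by_cases hc : Covers Φ U N (2 ^ (d + 1) * (T + t)) X' s
    · exact Or.inl ⟨X', s, by omega, by omega, fun y hy => Or.inl hy, hc⟩
    unfold Covers at hc
    push Not at hc
    obtain ⟨m, x, hx, hxs⟩ := hc
    obtain ⟨K, hKr, hK⟩ := hΦ m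
    obtain ⟨e, v, he, hvU, hv⟩ := exists_spanning_mod K U
    obtain ⟨s', hs'⟩ : ∃ s', s' = s ∪ Finset.univ.image fun i => Φ m (v i) := ⟨_, rfl⟩
    have hcard : s'.card ≤ s.card + r := by
      have h1 := Finset.card_union_le s (Finset.univ.image fun i => Φ m (v i))
      have h2 : (Finset.univ.image fun i => Φ m (v i)).card ≤ _ := Finset.card_image_le
      rw [Finset.card_univ, Fintype.card_fin] at h2
      rw [hs']
      omega
    have hpow : 2 ^ d * (2 * T + t + t) = 2 ^ (d + 1) * (T + t) := by ring
    rcases ih (2 * T + t) (X' ⊓ K) s' with ⟨X'', s'', hX'', hs'', hmem, hcov⟩ | hexp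
    · left
      refine ⟨X'', s'', ?_, ?_, ?_, hpow ▸ hcov⟩
      · have := codim_inf_le X' K
        rw [add_mul]
        omega
      · rw [add_mul]
        omega
      · intro y hy
        rcases hmem y hy with h | h
        · rcases Finset.mem_union.1 (hs' ▸ h) with h | h
          · exact Or.inl h
          · obtain ⟨i, -, rfl⟩ := Finset.mem_image.1 h
            exact Or.inr ⟨m, v i, hvU i, rfl⟩
        · exact Or.inr h
    · right
      refine hexp.succ hN hK (hs' ▸ Finset.subset_union_left) (fun z hz => ?_) hx hxs ?_
      · obtain ⟨c, hc⟩ := hv z hz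
        refine ⟨∑ i, c i • Φ m (v i), sum_mem fun i _ => smul_mem _ _ (subset_span ?_), ?_⟩
        · rw [Finset.mem_coe, hs']
          exact Finset.mem_union_right _ (Finset.mem_image_of_mem _ (Finset.mem_univ i))
        · have := hK (z - ∑ i, c i • v i)
            ⟨hc, sub_mem hz (sum_mem fun i _ => smul_mem _ _ (hvU i))⟩
          simpa [map_sum] using this
      · have : 1 ≤ 2 ^ d := Nat.one_le_two_pow
        rw [← hpow]
        nlinarith

/-- Structure of linear spaces of linear maps that have bounded rank modulo a filtration. -/
theorem exists_covers {Φ : M →ₗ[F] X →ₗ[F] Y} {U : Submodule F X} {N : ℕ → Set Y}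
    (hN : IsFiltration F N) {r t : ℕ}
    (hΦ : ∀ m, ∃ K : Submodule F X, codim K ≤ r ∧ ∀ x ∈ K ⊓ U, Φ m x ∈ N t) :
    ∃ (X' : Submodule F X) (s : Finset Y), codim X' ≤ (r + 1) * r ∧ s.card ≤ (r + 1) * r ∧
      (∀ y ∈ s, ∃ m, ∃ x ∈ U, y = Φ m x) ∧ Covers Φ U N (2 ^ (r + 2) * t) X' s := by
  rcases exists_covers_or_expands hN hΦ (r + 1) t ⊤ ∅ with ⟨X', s, hX', hs, hmem, hcov⟩ | h
  · refine ⟨X', s, by simpa [codim_top] using hX', by simpa using hs, fun y hy => ?_, ?_⟩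
    · simpa using hmem y hy
    · convert hcov using 1
      ring
  -- A space of dimension `r + 1` meets the near-kernel of `B`, which has codimension at most `r`,
  -- so expansion is impossible.
  · obtain ⟨B, Z, hZd, hZ, hB⟩ := h
    obtain ⟨K, hKr, hK⟩ := hΦ B
    have h1 := Submodule.finrank_sup_add_finrank_inf_eq Z K
    have h2 := Submodule.finrank_le (Z ⊔ K)
    have h3 := codim_add_finrank K
    have : Z ⊓ K ≠ ⊥ := by
      intro h
      rw [h, finrank_bot] at h1
      omega
    obtain ⟨z, hz, hz0⟩ := exists_mem_ne_zero_of_ne_bot this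
    exact absurd (hK z ⟨hz.2, (hZ hz.1).2⟩) (by simpa using hB z hz.1 hz0 0 (zero_mem _))

end Cover

/-! ### Compression over a finite field. -/

section Counting

variable {F M X W : Type*} [Field F] [Finite F] [AddCommGroup M] [Module F M]
  [FiniteDimensional F M] [AddCommGroup X] [Module F X] [FiniteDimensional F X]
  [AddCommGroup W] [Module F W]

/-- If a vector space over a finite field is a union of `|F| ^ b` subspaces then one of them has
codimension at most `b`. -/
theorem exists_codim_le_of_cover {ι : Type*} [Finite ι] {b : ℕ} (S : ι → Submodule F M)
    (hι : Nat.card ι ≤ Nat.card F ^ b) (hS : ∀ m, ∃ i, m ∈ S i) : ∃ i, codim (S i) ≤ b := by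
  by_contra! h
  have : Fintype ι := Fintype.ofFinite ι
  have : Finite M := Module.finite_of_finite F
  have hq : 1 < Nat.card F := Finite.one_lt_card
  have h1 : Nat.card M ≤ ∑ i, Nat.card (S i) := by
    have hsurj : Function.Surjective (fun x : Σ i, S i => (x.2 : M)) := fun m => by
      obtain ⟨i, hi⟩ := hS m
      exact ⟨⟨i, m, hi⟩, rfl⟩
    have := Nat.card_le_card_of_surjective _ hsurj
    rwa [Nat.card_sigma] at this
  -- The cover is nonempty, so some `S i₀` has codimension above `b`; hence the natural subtraction
  -- in `finrank F M - b - 1` is not truncated.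
  obtain ⟨i₀, -⟩ := hS 0
  have hM : b < finrank F M := by
    have := h i₀
    have := codim_add_finrank (S i₀)
    omega
  have h2 : ∀ i, Nat.card (S i) ≤ Nat.card F ^ (finrank F M - b - 1) := by
    intro i
    rw [Module.natCard_eq_pow_finrank (K := F)]
    refine Nat.pow_le_pow_right hq.le ?_
    have := h i
    have := codim_add_finrank (S i)
    omega
  have h3 := h1.trans (Finset.sum_le_card_nsmul _ _ _ fun i _ => h2 i)
  rw [Finset.card_univ, ← Nat.card_eq_fintype_card, Module.natCard_eq_pow_finrank (K := F) (V := M),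
    smul_eq_mul] at h3
  have h4 := h3.trans (Nat.mul_le_mul_right _ hι)
  rw [← pow_add] at h4
  have := (Nat.pow_le_pow_iff_right hq).1 h4
  omega

/-- Each image `Λ m X'` is a proper subspace of `W'`, so a functional nonzero on `W'` kills it.
There are at most `|F| ^ dim W` functionals, so one `k` serves a subspace of `M` of codimension at
most `dim W`. Imposing `k (Λ (e i) x) = 0` for representatives `e i` of the quotient makes `k` serve
every `m`. -/
theorem exists_compression_step {Λ : M →ₗ[F] X →ₗ[F] W} [FiniteDimensional F W] {r : ℕ}
    (hΛ : ∀ m, ∃ K : Submodule F X, codim K ≤ r ∧ ∀ x ∈ K, Λ m x = 0)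
    {X' : Submodule F X} {W' : Submodule F W} (h : ∀ m, ∀ x ∈ X', Λ m x ∈ W')
    (hr : r < finrank F W') :
    ∃ (X'' : Submodule F X) (W'' : Submodule F W), codim X'' ≤ codim X' + finrank F W ∧
      finrank F W'' < finrank F W' ∧ ∀ m, ∀ x ∈ X'', Λ m x ∈ W'' := by
  have : Finite (Dual F W) := Module.finite_of_finite F
  let ι := {k : Dual F W // ¬ W' ≤ LinearMap.ker k}
  let S : ι → Submodule F M := fun k =>
    { carrier := {m | ∀ x ∈ X', k.1 (Λ m x) = 0}
      add_mem' := fun {a b} ha hb x hx => by simp [ha x hx, hb x hx]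
      zero_mem' := fun x _ => by simp
      smul_mem' := fun c a ha x hx => by simp [ha x hx] }
  have hcard : Nat.card ι ≤ Nat.card F ^ finrank F W := by
    refine (Nat.card_le_card_of_injective Subtype.val Subtype.val_injective).trans ?_
    rw [Module.natCard_eq_pow_finrank (K := F), Subspace.dual_finrank_eq]
  obtain ⟨⟨k, hk⟩, hkS⟩ := exists_codim_le_of_cover S hcard fun m => by
    obtain ⟨K, hK, hK0⟩ := hΛ m
    have hle : X'.map (Λ m) ≤ W' := by
      rintro _ ⟨x, hx, rfl⟩
      exact h m x hx
    have hrk : finrank F (X'.map (Λ m)) ≤ r := by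
      have h1 : finrank F (X'.map (Λ m)) ≤ finrank F (LinearMap.range (Λ m)) :=
        Submodule.finrank_mono LinearMap.map_le_range
      have h2 := LinearMap.finrank_range_add_finrank_ker (Λ m)
      have h3 : finrank F K ≤ finrank F (LinearMap.ker (Λ m)) :=
        Submodule.finrank_mono fun x hx => hK0 x hx
      have := codim_add_finrank K
      omega
    have hnle : ¬ W' ≤ X'.map (Λ m) := fun hcon => by
      have := Submodule.finrank_mono hcon
      omega
    obtain ⟨w, hw, hwn⟩ := Set.not_subset.1 hnle
    obtain ⟨k, hkw, hk⟩ := Submodule.exists_dual_map_eq_bot_of_notMem hwn inferInstance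
    refine ⟨⟨k, fun hcon => hkw (hcon hw)⟩, fun x hx => ?_⟩
    have : k (Λ m x) ∈ (X'.map (Λ m)).map k := mem_map_of_mem (mem_map_of_mem hx)
    rwa [hk, mem_bot] at this
  obtain ⟨d, e, hd, -, he⟩ := exists_spanning_mod (S ⟨k, hk⟩) ⊤
  obtain ⟨L, hL, hL0⟩ := exists_codim_le_of_functionals fun i => k ∘ₗ Λ (e i)
  refine ⟨X' ⊓ L, W' ⊓ LinearMap.ker k, ?_, ?_, ?_⟩
  · have := codim_inf_le X' L
    omega
  · exact Submodule.finrank_lt_finrank_of_lt (lt_of_le_of_ne inf_le_left fun hcon =>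
      hk (inf_eq_left.1 hcon))
  · rintro m x ⟨hx, hxL⟩
    refine ⟨h m x hx, ?_⟩
    obtain ⟨c, hc⟩ := he m trivial
    have h1 : k (Λ (m - ∑ i, c i • e i) x) = 0 := hc x hx
    have h2 : ∀ i, k (Λ (e i) x) = 0 := fun i => hL0 x hxL i
    simpa [map_sum, LinearMap.sum_apply, h2] using h1

/-- A space of linear maps of rank at most `r` into a space of bounded dimension takes values, on a
subspace of bounded codimension, in a subspace of dimension at most `r`. -/
theorem exists_compression {Λ : M →ₗ[F] X →ₗ[F] W} [FiniteDimensional F W] {r : ℕ}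
    (hΛ : ∀ m, ∃ K : Submodule F X, codim K ≤ r ∧ ∀ x ∈ K, Λ m x = 0) :
    ∃ (X' : Submodule F X) (W' : Submodule F W), codim X' ≤ finrank F W * finrank F W ∧
      finrank F W' ≤ r ∧ ∀ m, ∀ x ∈ X', Λ m x ∈ W' := by
  -- Each step lowers the dimension of the target, so `finrank F W` steps suffice.
  have key : ∀ d, ∃ (X' : Submodule F X) (W' : Submodule F W), codim X' ≤ d * finrank F W ∧
      (finrank F W' ≤ r ∨ finrank F W' + d ≤ finrank F W) ∧ ∀ m, ∀ x ∈ X', Λ m x ∈ W' := by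
    intro d
    induction d with
    | zero => exact ⟨⊤, ⊤, by simp [codim_top], by simp, by simp⟩
    | succ d ih =>
      obtain ⟨X', W', hX', hW', h⟩ := ih
      by_cases hr : finrank F W' ≤ r
      · exact ⟨X', W', hX'.trans (Nat.mul_le_mul_right _ (by omega)), Or.inl hr, h⟩
      · obtain ⟨X'', W'', h1, h2, h3⟩ := exists_compression_step hΛ h (by omega)
        refine ⟨X'', W'', ?_, ?_, h3⟩
        · rw [add_mul]
          omega
        · omega
  obtain ⟨X', W', hX', hW', h⟩ := key (finrank F W)
  exact ⟨X', W', hX', by omega, h⟩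

end Counting

/-! ### Projections and transport of codimension. -/

theorem exists_projection {F V : Type*} [Field F] [AddCommGroup V] [Module F V]
    (U : Submodule F V) : ∃ p : V →ₗ[F] U, ∀ x : U, p x = x := by
  obtain ⟨p, hp⟩ := LinearMap.exists_leftInverse_of_injective U.subtype U.ker_subtype
  exact ⟨p, fun x => LinearMap.congr_fun hp x⟩

section Codim

variable {F V : Type*} [Field F] [AddCommGroup V] [Module F V] [FiniteDimensional F V]

theorem codim_comap_le {V' : Type*} [AddCommGroup V'] [Module F V'] [FiniteDimensional F V']
    (f : V' →ₗ[F] V) (K : Submodule F V) : codim (K.comap f) ≤ codim K := by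
  have : K.comap f = LinearMap.ker (K.mkQ ∘ₗ f) := by
    rw [LinearMap.ker_comp, ker_mkQ]
  rw [this]
  exact codim_ker_le _

theorem codim_map_subtype (U : Submodule F V) (X : Submodule F U) :
    codim (X.map U.subtype) = codim U + codim X := by
  have h1 := codim_add_finrank (X.map U.subtype)
  have h2 := codim_add_finrank U
  have h3 := codim_add_finrank X
  rw [finrank_map_subtype_eq] at h1
  omega

end Codim

/-! ### From approximate values to an exact linear family. -/

section LinearChoice

variable {F M X Y : Type*} [Field F] [AddCommGroup M] [Module F M] [AddCommGroup X] [Module F X]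
  [AddCommGroup Y] [Module F Y]

theorem eq_zero_of_finrank_le_zero [FiniteDimensional F Y] {W : Submodule F Y}
    (hW : finrank F W ≤ 0) {w : Y} (hw : w ∈ W) : w = 0 := by
  have : W = ⊥ := Submodule.finrank_eq_zero.1 (Nat.le_zero.1 hW)
  rwa [this, mem_bot] at hw

theorem exists_complement_singleton [FiniteDimensional F Y] {W : Submodule F Y} {w : Y}
    (hw : w ∈ W) (hw0 : w ≠ 0) :
    ∃ W' ≤ W, finrank F W' < finrank F W ∧ ∀ v ∈ W, ∃ c : F, v - c • w ∈ W' := by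
  obtain ⟨φ, hφ, -⟩ := Submodule.exists_dual_map_eq_bot_of_notMem
    (p := (⊥ : Submodule F Y)) (x := w) (by rwa [mem_bot]) inferInstance
  have hlt : W ⊓ LinearMap.ker φ < W := lt_of_le_of_ne inf_le_left fun hcon =>
    hφ (inf_eq_left.1 hcon hw)
  refine ⟨_, inf_le_left, Submodule.finrank_lt_finrank_of_lt hlt, fun v hv =>
    ⟨φ v / φ w, sub_mem hv (smul_mem _ _ hw), ?_⟩⟩
  simp [div_mul_cancel₀ _ hφ]

/-- An approximation of a linear family by elements of a subspace that meets the error set only in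
zero is unique, hence linear. -/
theorem exists_linear_choice {Φ : M →ₗ[F] X →ₗ[F] Y} {N : ℕ → Set Y} (hN : IsFiltration F N)
    {R k : ℕ} (hk : 3 * R ≤ k) {U : Submodule F X} {W : Submodule F Y}
    (hW : ∀ w ∈ W, w ∈ N k → w = 0) (h : ∀ m, ∀ x ∈ U, ∃ w ∈ W, Φ m x - w ∈ N R) :
    ∃ Λ : M →ₗ[F] U →ₗ[F] W, ∀ m (x : U), Φ m x - (Λ m x).1 ∈ N R := by
  have h' : ∀ m (x : U), ∃ w : W, Φ m x - w.1 ∈ N R := fun m x => by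
    obtain ⟨w, hw, hwR⟩ := h m x x.2
    exact ⟨⟨w, hw⟩, hwR⟩
  choose g hg using h'
  have huniq : ∀ (v w : W), v.1 - w.1 ∈ N (3 * R) → v = w := by
    intro v w hvw
    have := hW _ (sub_mem v.2 w.2) (hN.mono hk hvw)
    exact Subtype.ext (sub_eq_zero.1 this)
  refine ⟨LinearMap.mk₂ F g ?_ ?_ ?_ ?_, fun m x => hg m x⟩
  · intro m m' x
    refine huniq _ _ ?_
    have := hN.sub_mem (hN.add_mem (hg m x) (hg m' x)) (hg (m + m') x)
    convert hN.mono (by omega : R + R + R ≤ 3 * R) this using 1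
    simp only [map_add, LinearMap.add_apply, Submodule.coe_add]
    abel
  · intro c m x
    refine huniq _ _ ?_
    have := hN.sub_mem (hN.smul_mem c (hg m x)) (hg (c • m) x)
    convert hN.mono (by omega : R + R ≤ 3 * R) this using 1
    simp only [map_smul, LinearMap.smul_apply, Submodule.coe_smul, smul_sub]
    abel
  · intro m x x'
    refine huniq _ _ ?_
    have := hN.sub_mem (hN.add_mem (hg m x) (hg m x')) (hg m (x + x'))
    convert hN.mono (by omega : R + R + R ≤ 3 * R) this using 1
    simp only [map_add, Submodule.coe_add]
    abel
  · intro c m x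
    refine huniq _ _ ?_
    have := hN.sub_mem (hN.smul_mem c (hg m x)) (hg m (c • x))
    convert hN.mono (by omega : R + R ≤ 3 * R) this using 1
    simp only [map_smul, Submodule.coe_smul, smul_sub]
    abel

/-- A family of filtrations indexed by the subspaces of `X` for which every element of level `k`
drops to level `0` on a subspace of codimension at most `k`. -/
structure IsRestrictable (N : Submodule F X → ℕ → Set Y) : Prop where
  filtration : ∀ U, IsFiltration F (N U)
  anti : ∀ {U U' : Submodule F X} {R}, U' ≤ U → N U R ⊆ N U' R
  restrict : ∀ {U : Submodule F X} {k w}, w ∈ N U k → ∃ U' ≤ U, codim U' ≤ codim U + k ∧ w ∈ N U' 0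

/-- A subspace `W` can be shrunk, together with the domain `U`, until all its nonzero elements have
level larger than `k`. -/
theorem exists_regular [FiniteDimensional F Y] {N : Submodule F X → ℕ → Set Y}
    (hN : IsRestrictable N) (Φ : M →ₗ[F] X →ₗ[F] Y) (R k b : ℕ) :
    ∀ (U₀ : Submodule F X) (W₀ : Submodule F Y), finrank F W₀ ≤ b →
      (∀ m, ∀ x ∈ U₀, ∃ w ∈ W₀, Φ m x - w ∈ N U₀ R) →
      ∃ (U : Submodule F X) (W : Submodule F Y), W ≤ W₀ ∧
        codim U ≤ codim U₀ + b * k ∧ (∀ w ∈ W, w ∈ N U k → w = 0) ∧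
        ∀ m, ∀ x ∈ U, ∃ w ∈ W, Φ m x - w ∈ N U R := by
  induction b with
  | zero =>
    intro U₀ W₀ hb h
    exact ⟨U₀, W₀, le_rfl, by omega, fun w hw _ => eq_zero_of_finrank_le_zero hb hw, h⟩
  | succ b ih =>
    intro U₀ W₀ hb h
    by_cases hreg : ∀ w ∈ W₀, w ∈ N U₀ k → w = 0
    · exact ⟨U₀, W₀, le_rfl, by omega, hreg, h⟩
    -- A nonzero `w` of low level becomes negligible on a smaller domain, at cost `k`; multiples of
    -- `w` then join the error at level `0`, so `R` does not grow while the dimension of `W₀` drops.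
    push Not at hreg
    obtain ⟨w, hw, hwk, hw0⟩ := hreg
    obtain ⟨U₁, hU₁, hU₁k, hwU₁⟩ := hN.restrict hwk
    obtain ⟨W', hW', hlt, hsub⟩ := exists_complement_singleton hw hw0
    obtain ⟨U, W, hW, hU, hr, hΦ⟩ := ih U₁ W' (by omega) fun m x hx => by
      obtain ⟨v, hv, hvR⟩ := h m x (hU₁ hx)
      obtain ⟨c, hc⟩ := hsub v hv
      refine ⟨v - c • w, hc, ?_⟩
      rw [← sub_add]
      exact (hN.filtration U₁).add_mem (hN.anti hU₁ hvR) ((hN.filtration U₁).smul_mem c hwU₁)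
    refine ⟨U, W, hW.trans hW', hU.trans ?_, hr, hΦ⟩
    rw [add_mul]
    omega

/-- A linear family `Φ` of linear maps of rank at most `r` modulo a filtration agrees, up to a small
error, with a family of linear maps into a fixed space of dimension at most `r`. -/
theorem exists_low_dim_approximation [Finite F] [FiniteDimensional F M] [FiniteDimensional F X]
    [FiniteDimensional F Y] {N : Submodule F X → ℕ → Set Y} (hN : IsRestrictable N)
    {Φ : M →ₗ[F] X →ₗ[F] Y} {r t b R k : ℕ} (hb : (r + 1) * r ≤ b) (hR : 2 ^ (r + 2) * t ≤ R)
    (hk : 3 * R + t ≤ k)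
    (hΦ : ∀ m, ∃ K : Submodule F X, codim K ≤ r ∧ ∀ x ∈ K, Φ m x ∈ N ⊤ t) :
    ∃ (U : Submodule F X) (n : ℕ) (w : Fin n → Y) (l : Fin n → M →ₗ[F] X →ₗ[F] F),
      n ≤ r ∧ codim U ≤ b + b * k + b * b ∧
      (∀ i, w i ∈ span F {y | ∃ m x, y = Φ m x}) ∧
      (∀ m, ∀ x ∈ U, Φ m x - ∑ i, l i m x • w i ∈ N U R) ∧
      ∀ m (K : Submodule F X), (∀ x ∈ K, Φ m x ∈ N ⊤ t) → ∀ x ∈ K ⊓ U, ∀ i, l i m x = 0 := by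
  obtain ⟨V₁, s, hV₁, hs, hmem, hcov⟩ := exists_covers (U := ⊤) (hN.filtration ⊤)
    (fun m => by simpa using hΦ m)
  have hfin : finrank F (span F (s : Set Y)) ≤ b :=
    (finrank_span_finset_le_card s).trans (hs.trans hb)
  obtain ⟨U, W, hW, hU, hreg, happ⟩ := exists_regular hN Φ R k b V₁ _ hfin fun m x hx => by
    obtain ⟨y, hy, hyN⟩ := hcov m x ⟨hx, trivial⟩
    exact ⟨y, hy, hN.anti le_top ((hN.filtration _).mono hR hyN)⟩
  obtain ⟨Λ, hΛ⟩ := exists_linear_choice (hN.filtration U) (by omega : 3 * R ≤ k) hreg happ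
  -- On `K` the approximant has level at most `t + R ≤ k`, so regularity of `W` makes it exactly
  -- zero. Thus `Λ m` has rank at most `r` with no error.
  have hΛ0 : ∀ m (K : Submodule F X), (∀ x ∈ K, Φ m x ∈ N ⊤ t) → ∀ x : U, x.1 ∈ K → Λ m x = 0 := by
    intro m K hK x hx
    have := (hN.filtration U).sub_mem (hN.anti le_top (hK x hx)) (hΛ m x)
    rw [sub_sub_cancel] at this
    exact Subtype.ext (hreg _ (Λ m x).2 ((hN.filtration U).mono (by omega) this))
  obtain ⟨X', W', hX', hW', hΛW⟩ := exists_compression (Λ := Λ) (r := r) fun m => by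
    obtain ⟨K, hK, hKN⟩ := hΦ m
    exact ⟨K.comap U.subtype, (codim_comap_le _ _).trans hK, fun x hx => hΛ0 m K hKN x hx⟩
  have hWb : finrank F W ≤ b := (Submodule.finrank_mono hW).trans hfin
  have hle : X'.map U.subtype ≤ U := map_subtype_le U X'
  obtain ⟨p, hp⟩ := exists_projection (X'.map U.subtype)
  obtain ⟨q, hq⟩ := exists_projection W'
  let e := finBasis F W'
  -- The coordinates of `Λ` in `W'`, extended to all of `X` through a projection onto the final
  -- domain.
  let l : Fin (finrank F W') → M →ₗ[F] X →ₗ[F] F := fun i =>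
    (Λ.compl₂ (inclusion hle ∘ₗ p)).compr₂ (e.coord i ∘ₗ q)
  have hl : ∀ i m x (hx : x ∈ X'.map U.subtype), l i m x = e.coord i (q (Λ m ⟨x, hle hx⟩)) := by
    intro i m x hx
    have : p x = ⟨x, hx⟩ := hp ⟨x, hx⟩
    simp only [l, LinearMap.compr₂_apply, LinearMap.compl₂_apply, LinearMap.comp_apply, this]
    rfl
  refine ⟨X'.map U.subtype, finrank F W', fun i => (e i : W), l, hW', ?_, fun i => ?_, ?_, ?_⟩
  · rw [codim_map_subtype]
    have := Nat.mul_le_mul hWb hWb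
    omega
  · refine span_mono ?_ (hW (e i : W).2)
    intro y hy
    obtain ⟨m, x, -, h⟩ := hmem y hy
    exact ⟨m, x, h⟩
  · intro m x hx
    have hx' : (⟨x, hle hx⟩ : U) ∈ X' := by
      obtain ⟨x', hx', rfl⟩ := hx
      exact hx'
    have h1 : ∑ i, l i m x • ((e i : W) : Y) = (Λ m ⟨x, hle hx⟩ : W) := by
      have h2 : q (Λ m ⟨x, hle hx⟩) = ⟨Λ m ⟨x, hle hx⟩, hΛW m _ hx'⟩ := hq ⟨_, hΛW m _ hx'⟩
      have h3 := congrArg (fun v : W' => ((v : W) : Y)) (e.sum_repr (q (Λ m ⟨x, hle hx⟩)))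
      simp only [Submodule.coe_sum, Submodule.coe_smul] at h3
      simp only [hl _ m x hx, Basis.coord_apply]
      rw [h3, h2]
    rw [h1]
    exact hN.anti hle (hΛ m ⟨x, hle hx⟩)
  · rintro m K hK x ⟨hxK, hx⟩ i
    rw [hl i m x hx, hΛ0 m K hK _ hxK, map_zero, map_zero]

end LinearChoice

/-! ### Bilinear forms of low rank. -/

section Bilinear

variable {F V M : Type*} [Field F] [AddCommGroup V] [Module F V] [FiniteDimensional F V]
  [AddCommGroup M] [Module F M]

/-- The bilinear forms whose restriction to `U` has a left kernel of codimension at most `R`. -/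
def lowRank (U : Submodule F V) (R : ℕ) : Set (V →ₗ[F] V →ₗ[F] F) :=
  {β | ∃ K : Submodule F V, codim K ≤ R ∧ ∀ y ∈ K ⊓ U, ∀ z ∈ U, β y z = 0}

theorem isFiltration_lowRank (U : Submodule F V) : IsFiltration F (lowRank U) where
  mono := fun _ _ hab _ ⟨K, hK, h⟩ => ⟨K, hK.trans hab, h⟩
  smul_mem := fun c _ _ ⟨K, hK, h⟩ => ⟨K, hK, fun y hy z hz => by simp [h y hy z hz]⟩
  add_mem := fun ⟨K, hK, h⟩ ⟨L, hL, h'⟩ => ⟨K ⊓ L, (codim_inf_le K L).trans (add_le_add hK hL),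
    fun y hy z hz => by simp [h y ⟨hy.1.1, hy.2⟩ z hz, h' y ⟨hy.1.2, hy.2⟩ z hz]⟩
  zero_mem := ⟨⊤, codim_top.le, fun _ _ _ _ => rfl⟩

theorem isRestrictable_lowRank :
    IsRestrictable (lowRank : Submodule F V → ℕ → Set (V →ₗ[F] V →ₗ[F] F)) where
  filtration := isFiltration_lowRank
  anti := fun h _ ⟨K, hK, hβ⟩ => ⟨K, hK, fun y hy z hz => hβ y ⟨hy.1, h hy.2⟩ z (h hz)⟩
  restrict := fun {U _ _} ⟨K, hK, hβ⟩ => ⟨U ⊓ K, inf_le_left,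
    (codim_inf_le U K).trans (Nat.add_le_add_left hK _), ⊤, codim_top.le,
    fun y hy z hz => hβ y ⟨hy.2.2, hy.2.1⟩ z hz.1⟩

/-- Modulo `L`, the space `U` is spanned by at most `b` vectors; orthogonality of `y` to them costs
`b` further conditions. -/
theorem mem_lowRank_of_vanish {U K L : Submodule F V} {a b : ℕ} {β : V →ₗ[F] V →ₗ[F] F}
    (hK : codim K ≤ a) (hL : codim L ≤ b) (h : ∀ y ∈ K ⊓ U, ∀ z ∈ L ⊓ U, β y z = 0) :
    β ∈ lowRank U (a + b) := by
  obtain ⟨d, e, hd, heU, he⟩ := exists_spanning_mod L U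
  obtain ⟨L', hL', hL0⟩ := exists_codim_le_of_functionals fun i => β.flip (e i)
  refine ⟨K ⊓ L', (codim_inf_le K L').trans (by omega), fun y hy z hz => ?_⟩
  obtain ⟨c, hc⟩ := he z hz
  have h1 := h y ⟨hy.1.1, hy.2⟩ _ ⟨hc, sub_mem hz (sum_mem fun i _ => smul_mem _ _ (heU i))⟩
  have h2 : ∀ i, β y (e i) = 0 := fun i => hL0 y hy.1.2 i
  simpa [map_sum, h2] using h1

/-- A space of symmetric trilinear forms of bounded rank all of whose derivatives have bounded rank
vanishes on a subspace of bounded codimension. -/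
theorem exists_vanishing {Φ : M →ₗ[F] V →ₗ[F] V →ₗ[F] V →ₗ[F] F}
    (h12 : ∀ m x y z, Φ m x y z = Φ m y x z) (h23 : ∀ m x y z, Φ m x y z = Φ m x z y)
    {U : Submodule F V} {r ρ D : ℕ} (hD : r + r * ρ ≤ D)
    (hΦ : ∀ m, ∃ K : Submodule F V, codim K ≤ r ∧
      ∀ x ∈ K ⊓ U, ∀ y ∈ K ⊓ U, ∀ z ∈ K ⊓ U, Φ m x y z = 0)
    (hρ : ∀ m, ∀ x ∈ U, Φ m x ∈ lowRank U ρ) :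
    ∃ U' ≤ U, codim U' ≤ codim U + ((D + 1) * D + (D + 1) * D * ρ) ∧
      ∀ m, ∀ x ∈ U', ∀ y ∈ U', ∀ z ∈ U', Φ m x y z = 0 := by
  -- A constant filtration: the dichotomy is applied with exact vanishing on `U` as the only notion
  -- of smallness.
  let N : ℕ → Set (V →ₗ[F] V →ₗ[F] F) := fun _ => {β | ∀ y ∈ U, ∀ z ∈ U, β y z = 0}
  have hN : IsFiltration F N :=
    { mono := fun _ _ _ _ h => h
      smul_mem := fun c _ _ h y hy z hz => by simp [h y hy z hz]
      add_mem := fun h h' y hy z hz => by simp [h y hy z hz, h' y hy z hz]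
      zero_mem := fun _ _ _ _ => rfl }
  -- Let `e i` span `U` modulo `K`. If `x` lies in `K` and in the kernels of all `Φ m (e i)`,
  -- symmetry kills `Φ m x` on pairs involving some `e i`, and the hypothesis kills it on `K`.
  have hker : ∀ m, ∃ K : Submodule F V, codim K ≤ D ∧ ∀ x ∈ K ⊓ U, Φ m x ∈ N 0 := by
    intro m
    obtain ⟨K, hK, hK0⟩ := hΦ m
    obtain ⟨d, e, hd, heU, he⟩ := exists_spanning_mod K U
    have hL : ∀ i, ∃ L : Submodule F V, codim L ≤ ρ ∧ ∀ y ∈ L ⊓ U, ∀ z ∈ U, Φ m (e i) y z = 0 :=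
      fun i => hρ m (e i) (heU i)
    choose L hLρ hL using hL
    obtain ⟨L', hL', hLL'⟩ := exists_iInf_codim_le Finset.univ L fun i _ => hLρ i
    refine ⟨K ⊓ L', ?_, ?_⟩
    · refine (codim_inf_le K L').trans (le_trans ?_ hD)
      rw [Finset.card_univ, Fintype.card_fin] at hL'
      exact add_le_add hK (hL'.trans (Nat.mul_le_mul_right _ (hd.trans hK)))
    · rintro x ⟨⟨hxK, hxL⟩, hxU⟩
      have hxe : ∀ i, ∀ z ∈ U, Φ m x (e i) z = 0 := fun i z hz => by
        rw [h12]
        exact hL i x ⟨hLL' i (Finset.mem_univ i) hxL, hxU⟩ z hz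
      have hred : ∀ z ∈ U, (∀ y ∈ K ⊓ U, Φ m x y z = 0) → ∀ y ∈ U, Φ m x y z = 0 := by
        intro z hz hy0 y hy
        obtain ⟨c, hc⟩ := he y hy
        have := hy0 _ ⟨hc, sub_mem hy (sum_mem fun i _ => smul_mem _ _ (heU i))⟩
        simpa [map_sum, LinearMap.sum_apply, hxe _ z hz] using this
      intro y hy z hz
      refine hred z hz (fun y hy => ?_) y hy
      rw [h23]
      exact hred y hy.2 (fun z hz => hK0 x ⟨hxK, hxU⟩ z hz y hy) z hz
  obtain ⟨X, s, hX, hs, hmem, hcov⟩ := exists_covers (t := 0) hN hker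
  have hL : ∀ β : V →ₗ[F] V →ₗ[F] F, ∃ L : Submodule F V, β ∈ s → codim L ≤ ρ ∧
      ∀ y ∈ L ⊓ U, ∀ z ∈ U, β y z = 0 := by
    intro β
    by_cases hβ : β ∈ s
    · obtain ⟨m, x, hx, rfl⟩ := hmem β hβ
      obtain ⟨L, hL⟩ := hρ m x hx
      exact ⟨L, fun _ => hL⟩
    · exact ⟨⊤, fun h => absurd h hβ⟩
  choose L hL using hL
  -- The covering forms are themselves derivatives, hence of rank at most `ρ` on `U`; intersecting
  -- their kernels kills their whole span.
  obtain ⟨L', hL', hLL'⟩ := exists_iInf_codim_le s L fun β hβ => (hL β hβ).1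
  refine ⟨U ⊓ (X ⊓ L'), inf_le_left, ?_, ?_⟩
  · have h1 := codim_inf_le U (X ⊓ L')
    have h2 := codim_inf_le X L'
    have h3 := hL'.trans (Nat.mul_le_mul_right ρ hs)
    omega
  · rintro m x ⟨hxU, hxX, -⟩ y ⟨hyU, -, hyL⟩ z ⟨hzU, -⟩
    obtain ⟨β, hβ, hβN⟩ := hcov m x ⟨hxX, hxU⟩
    have h1 : Φ m x y z - β y z = 0 := hβN y hyU z hzU
    have hspan : span F (s : Set (V →ₗ[F] V →ₗ[F] F)) ≤
        LinearMap.ker (LinearMap.applyₗ z ∘ₗ LinearMap.applyₗ y) :=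
      span_le.2 fun β hβ => (hL β hβ).2 y ⟨hLL' β hβ hyL, hyU⟩ z hzU
    have h2 : β y z = 0 := hspan hβ
    rw [← h1, h2, sub_zero]

end Bilinear

/-! ### The numerical bound, measured in powers of `2 ^ r`. -/

theorem codim_bound_le {r : ℕ} (hr : 1 ≤ r) {b R k ρ D : ℕ} (hb : b = (r + 1) * r)
    (hR : R = 2 ^ (r + 2) * (r + r)) (hk : k = 3 * R + (r + r)) (hρ : ρ = R + (r + r))
    (hD : D = r + r * ρ) :
    b + b * k + b * b + ((D + 1) * D + (D + 1) * D * ρ) ≤ 2 ^ (30 * r) := by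
  obtain ⟨u, hu⟩ : ∃ u, u = 2 ^ r := ⟨_, rfl⟩
  have hru : r + 1 ≤ u := hu ▸ Nat.lt_two_pow_self
  have hu2 : 2 ≤ u := by omega
  have two : ∀ {x y n : ℕ}, x ≤ u ^ n → y ≤ u ^ n → x + y ≤ u ^ (n + 1) := by
    intro x y n hx hy
    rw [pow_succ]
    nlinarith
  have up : ∀ {x m n : ℕ}, x ≤ u ^ m → m ≤ n → x ≤ u ^ n := fun hx hmn =>
    hx.trans (Nat.pow_le_pow_right (by omega) hmn)
  have mul : ∀ {x y m n : ℕ}, x ≤ u ^ m → y ≤ u ^ n → x * y ≤ u ^ (m + n) := by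
    intro x y m n hx hy
    rw [pow_add]
    exact Nat.mul_le_mul hx hy
  have h1 : r + 1 ≤ u ^ 1 := by simpa using hru
  have h0 : r ≤ u ^ 1 := by omega
  have hone : ∀ n, 1 ≤ u ^ n := fun n => Nat.one_le_pow _ _ (by omega)
  have hb' : b ≤ u ^ 2 := hb ▸ mul h1 h0
  have hrr : r + r ≤ u ^ 2 := two h0 h0
  have h4 : 2 ^ (r + 2) ≤ u ^ 3 := by
    rw [pow_add, ← hu]
    nlinarith
  have hR' : R ≤ u ^ 5 := hR ▸ mul h4 hrr
  have h3 : 3 ≤ u ^ 2 := by nlinarith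
  have hk' : k ≤ u ^ 8 := hk ▸ two (mul h3 hR') (up hrr (by omega))
  have hρ' : ρ ≤ u ^ 6 := hρ ▸ two hR' (up hrr (by omega))
  have hD' : D ≤ u ^ 8 := hD ▸ two (up h0 (by omega)) (mul h0 hρ')
  have hD1 : D + 1 ≤ u ^ 9 := two hD' (hone 8)
  have h5 := two (up (mul hb' hb') (by omega : _ ≤ 11)) (two (up hb' (by omega)) (mul hb' hk'))
  have h6 := two (up (mul hD1 hD') (by omega)) (mul (mul hD1 hD') hρ')
  have h7 := two (up h5 (by omega)) h6
  rw [pow_mul', ← hu]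
  refine le_trans (le_of_eq ?_) (up h7 (by omega))
  ring

/-! ### Spaces of symmetric trilinear forms. -/

section Trilinear

variable {F V M : Type*} [Field F] [Finite F] [AddCommGroup V] [Module F V]
  [FiniteDimensional F V] [AddCommGroup M] [Module F M] [FiniteDimensional F M]

set_option maxSynthPendingDepth 6 in
/-- Structure of linear spaces of symmetric trilinear forms each of which vanishes on a subspace of
codimension at most `r`. -/
theorem exists_trilinear_structure {Φ : M →ₗ[F] V →ₗ[F] V →ₗ[F] V →ₗ[F] F}
    (h12 : ∀ m x y z, Φ m x y z = Φ m y x z) (h23 : ∀ m x y z, Φ m x y z = Φ m x z y)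
    {r : ℕ} (hr : 1 ≤ r)
    (hΦ : ∀ m, ∃ K : Submodule F V, codim K ≤ r ∧
      ∀ x ∈ K, ∀ y ∈ K, ∀ z ∈ K, Φ m x y z = 0) :
    ∃ (U : Submodule F V) (n : ℕ) (w : Fin n → V →ₗ[F] V →ₗ[F] F)
      (l : Fin n → M →ₗ[F] V →ₗ[F] F), n ≤ r ∧ codim U ≤ 2 ^ (30 * r) ∧
      (∀ i, w i ∈ span F {β | ∃ m x, β = Φ m x}) ∧
      ∀ m, ∀ x ∈ U, ∀ y ∈ U, ∀ z ∈ U, Φ m x y z =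
        ∑ i, (l i m x * w i y z + l i m y * w i x z + l i m z * w i x y) := by
  have hlow : ∀ m (K : Submodule F V), codim K ≤ r →
      (∀ x ∈ K, ∀ y ∈ K, ∀ z ∈ K, Φ m x y z = 0) →
      ∀ x ∈ K, Φ m x ∈ lowRank ⊤ (r + r) := fun m K hK h x hx =>
    mem_lowRank_of_vanish hK hK fun y hy z hz => h x hx y hy.1 z hz.1
  obtain ⟨R, hR⟩ : ∃ R, R = 2 ^ (r + 2) * (r + r) := ⟨_, rfl⟩
  obtain ⟨U, n, w, l, hn, hU, hw, happ, hl⟩ := exists_low_dim_approximation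
    isRestrictable_lowRank (Φ := Φ) (r := r) (t := r + r) le_rfl hR.ge le_rfl fun m => by
      obtain ⟨K, hK, h⟩ := hΦ m
      exact ⟨K, hK, hlow m K hK h⟩
  have hwsymm : ∀ i y z, w i y z = w i z y := by
    intro i y z
    have hle : span F {β | ∃ m x, β = Φ m x} ≤ LinearMap.ker
        (LinearMap.applyₗ z ∘ₗ LinearMap.applyₗ y - LinearMap.applyₗ y ∘ₗ LinearMap.applyₗ z) := by
      rw [span_le]
      rintro _ ⟨m, x, rfl⟩
      exact sub_eq_zero.2 (h23 m x y z)
    exact sub_eq_zero.1 (hle (hw i))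
  let τ : M → V →ₗ[F] V →ₗ[F] V →ₗ[F] F := fun m => ∑ i, (l i m).smulRight (w i)
  have hτ : ∀ m x y z, τ m x y z = ∑ i, l i m x * w i y z := by
    intro m x y z
    simp [τ, LinearMap.sum_apply]
  let σ : (V →ₗ[F] V →ₗ[F] F) →ₗ[F] V →ₗ[F] V →ₗ[F] F := LinearMap.lflip.toLinearMap
  -- Remove the three placements of the linear factor, so that the remainder is again symmetric.
  let Ψ : M →ₗ[F] V →ₗ[F] V →ₗ[F] V →ₗ[F] F :=
    { toFun := fun m => Φ m - τ m - (τ m).flip - σ ∘ₗ (τ m).flip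
      map_add' := fun m m' => by
        ext x y z
        simp [σ, hτ, add_mul, Finset.sum_add_distrib]
        ring
      map_smul' := fun c m => by
        ext x y z
        simp [σ, hτ, mul_assoc, ← Finset.mul_sum]
        ring }
  have hΨ : ∀ m x y z, Ψ m x y z = Φ m x y z - τ m x y z - τ m y x z - τ m z x y :=
    fun _ _ _ _ => rfl
  have hτsymm : ∀ m x y z, τ m x y z = τ m x z y := by
    intro m x y z
    simp only [hτ, hwsymm _ y z]
  have hτ0 : ∀ m x, (∀ i, l i m x = 0) → ∀ y z, τ m x y z = 0 := by
    intro m x hx y z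
    simp [hτ, hx]
  obtain ⟨U', hU'U, hU', hΨ0⟩ := exists_vanishing (Φ := Ψ) (U := U) (r := r) (ρ := R + (r + r))
    (fun m x y z => by rw [hΨ, hΨ, h12, hτsymm m z x y]; ring)
    (fun m x y z => by rw [hΨ, hΨ, h23, hτsymm m x y z]; ring) le_rfl
    (fun m => by
      obtain ⟨K, hK, h⟩ := hΦ m
      refine ⟨K, hK, fun x hx y hy z hz => ?_⟩
      have h0 := hl m K (hlow m K hK h)
      rw [hΨ, h x hx.1 y hy.1 z hz.1, hτ0 m x (h0 x hx), hτ0 m y (h0 y hy), hτ0 m z (h0 z hz)]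
      ring)
    (fun m x hx => by
      obtain ⟨K, hK, h⟩ := hΦ m
      have h0 := hl m K (hlow m K hK h)
      have hN := isFiltration_lowRank U
      -- The approximation controls only the placement with `x` in the linear factor. The other two
      -- have rank at most `r`, since the forms `l i m` vanish on `K ⊓ U`.
      have hA : (τ m).flip x ∈ lowRank U (r + 0) := mem_lowRank_of_vanish hK codim_top.le
        fun y hy z _ => hτ0 m y (h0 y hy) x z
      have hB : σ ((τ m).flip x) ∈ lowRank U (0 + r) :=
        mem_lowRank_of_vanish codim_top.le hK fun y _ z hz => hτ0 m z (h0 z hz) x y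
      have := hN.sub_mem (hN.sub_mem (happ m x hx) hA) hB
      convert hN.mono (by omega : R + (r + 0) + (0 + r) ≤ R + (r + r)) this using 1
      refine LinearMap.ext₂ fun y z => ?_
      simp [σ, hΨ, hτ, LinearMap.sum_apply])
  refine ⟨U', n, w, l, hn, hU'.trans ?_, hw, fun m x hx y hy z hz => ?_⟩
  · exact (Nat.add_le_add_right hU _).trans (codim_bound_le hr rfl hR rfl rfl rfl)
  · have := hΨ0 m x hx y hy z hz
    rw [hΨ, hτ, hτ, hτ] at this
    simp only [Finset.sum_add_distrib]
    linear_combination this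

end Trilinear

/-! ### Degree, finite differences and quadratic functions. -/

section Degree

variable {p n : ℕ}

/-- The functions of degree at most `d`. -/
def degreeLE (p n d : ℕ) : Submodule (ZMod p) ((Fin n → ZMod p) → ZMod p) where
  carrier := {f | HasDegreeLE d f}
  add_mem' := by
    rintro f g ⟨P, hP, hPe⟩ ⟨Q, hQ, hQe⟩
    exact ⟨P + Q, (MvPolynomial.totalDegree_add _ _).trans (max_le hP hQ), fun x => by
      simp [hPe, hQe]⟩
  zero_mem' := ⟨0, by simp, by simp⟩
  smul_mem' := by
    rintro c f ⟨P, hP, hPe⟩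
    exact ⟨c • P, (MvPolynomial.totalDegree_smul_le _ _).trans hP, fun x => by
      simp [MvPolynomial.smul_eval, hPe]⟩

theorem degreeLE_mono {d e : ℕ} (h : d ≤ e) : degreeLE p n d ≤ degreeLE p n e :=
  fun _ ⟨P, hP, hPe⟩ => ⟨P, hP.trans h, hPe⟩

theorem const_mem_degreeLE (d : ℕ) (c : ZMod p) : (fun _ => c) ∈ degreeLE p n d :=
  ⟨MvPolynomial.C c, by simp, fun x => by simp⟩

theorem mul_mem_degreeLE {d e : ℕ} {f g : (Fin n → ZMod p) → ZMod p} (hf : f ∈ degreeLE p n d)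
    (hg : g ∈ degreeLE p n e) : f * g ∈ degreeLE p n (d + e) := by
  obtain ⟨P, hP, hPe⟩ := hf
  obtain ⟨Q, hQ, hQe⟩ := hg
  exact ⟨P * Q, (MvPolynomial.totalDegree_mul _ _).trans (add_le_add hP hQ), fun x => by
    simp [hPe, hQe]⟩

theorem coord_mem_degreeLE (i : Fin n) : (fun x => x i) ∈ degreeLE p n 1 :=
  ⟨MvPolynomial.monomial (Finsupp.single i 1) 1,
    (MvPolynomial.totalDegree_monomial_le _ _).trans (by simp),
    fun x => by simp [MvPolynomial.eval_monomial]⟩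

theorem exists_const_of_mem_degreeLE_zero {f : (Fin n → ZMod p) → ZMod p}
    (hf : f ∈ degreeLE p n 0) : ∃ c, f = fun _ => c := by
  obtain ⟨P, hP, hPe⟩ := hf
  rw [MvPolynomial.totalDegree_eq_zero_iff_eq_C.1 (Nat.le_zero.1 hP)] at hPe
  exact ⟨P.coeff 0, funext fun x => by rw [← hPe x, MvPolynomial.eval_C]⟩

/-- Functions of bounded degree are built from constants by addition and by multiplication with
coordinates. -/
theorem degreeLE_le_of_mul_coord {S : ℕ → Submodule (ZMod p) ((Fin n → ZMod p) → ZMod p)}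
    (hconst : ∀ d c, (fun _ => c) ∈ S d)
    (hmul : ∀ d i, ∀ g ∈ degreeLE p n d, g ∈ S d → (fun x => x i) * g ∈ S (d + 1)) (d : ℕ) :
    degreeLE p n d ≤ S d := by
  have key : ∀ (d : ℕ) (m : Fin n →₀ ℕ) (c : ZMod p), (m.sum fun _ e => e) ≤ d →
      (fun x => MvPolynomial.eval x (MvPolynomial.monomial m c)) ∈ S d := by
    intro d
    induction d with
    | zero =>
      intro m c hm
      have hm0 : m = 0 := (Finsupp.degree_eq_zero_iff m).1 (Nat.le_zero.1 hm)
      subst hm0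
      simpa using hconst 0 c
    | succ d ih =>
      intro m c hm
      by_cases hm0 : m = 0
      · subst hm0
        simpa using hconst (d + 1) c
      obtain ⟨i, hi⟩ := Finsupp.ne_iff.mp hm0
      have hle : Finsupp.single i 1 ≤ m := by
        rw [Finsupp.single_le_iff]
        exact Nat.one_le_iff_ne_zero.mpr (by simpa using hi)
      obtain ⟨m', rfl⟩ := exists_add_of_le hle
      rw [Finsupp.sum_add_index' (by simp) (by simp)] at hm
      simp only [Finsupp.sum_single_index] at hm
      have hm' : (m'.sum fun _ e => e) ≤ d := by omega
      convert hmul d i _ ⟨_, (MvPolynomial.totalDegree_monomial_le _ c).trans hm', fun x => rfl⟩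
        (ih m' c hm') using 1
      ext x
      have : MvPolynomial.monomial (Finsupp.single i 1 + m') c =
          MvPolynomial.X i * MvPolynomial.monomial m' c := by
        rw [MvPolynomial.X, MvPolynomial.monomial_mul, one_mul]
      simp [this]
  rintro f ⟨P, hP, hPe⟩
  have hf : f = ∑ m ∈ P.support, fun x =>
      MvPolynomial.eval x (MvPolynomial.monomial m (P.coeff m)) := by
    ext x
    rw [Finset.sum_apply, ← map_sum, ← MvPolynomial.as_sum, hPe]
  rw [hf]
  exact sum_mem fun m hm => key d m _ ((MvPolynomial.le_totalDegree hm).trans hP)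

theorem comp_mem_degreeLE {φ : (Fin n → ZMod p) → Fin n → ZMod p}
    (hφ : ∀ i, (fun x => φ x i) ∈ degreeLE p n 1) {d : ℕ} {f : (Fin n → ZMod p) → ZMod p}
    (hf : f ∈ degreeLE p n d) : f ∘ φ ∈ degreeLE p n d := by
  refine degreeLE_le_of_mul_coord (S := fun d => (degreeLE p n d).comap
    (LinearMap.funLeft (ZMod p) (ZMod p) φ)) (fun d c => const_mem_degreeLE d c) ?_ d hf
  intro d i g _ hg
  rw [add_comm d]
  exact mul_mem_degreeLE (hφ i) hg

theorem linear_mem_degreeLE (φ : (Fin n → ZMod p) →ₗ[ZMod p] ZMod p) :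
    (φ : (Fin n → ZMod p) → ZMod p) ∈ degreeLE p n 1 := by
  have : (φ : (Fin n → ZMod p) → ZMod p) =
      ∑ i, φ (fun j => if i = j then 1 else 0) • fun x => x i := by
    ext x
    rw [LinearMap.pi_apply_eq_sum_univ φ x]
    simp [mul_comm]
  rw [this]
  exact sum_mem fun i _ => smul_mem _ _ (coord_mem_degreeLE i)

theorem bilinear_mem_degreeLE (A : (Fin n → ZMod p) →ₗ[ZMod p] (Fin n → ZMod p) →ₗ[ZMod p] ZMod p) :
    (fun x => A x x) ∈ degreeLE p n 2 := by
  have : (fun x => A x x) = ∑ i, (fun x => x i) *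
      (A (fun j => if i = j then 1 else 0) : (Fin n → ZMod p) → ZMod p) := by
    ext x
    have := congrArg (fun l => l x) (LinearMap.pi_apply_eq_sum_univ A x)
    simpa using this
  rw [this]
  exact sum_mem fun i _ => mul_mem_degreeLE (coord_mem_degreeLE i) (linear_mem_degreeLE _)

/-- The discrete derivative of `f` in direction `y`. -/
def diff (y : Fin n → ZMod p) (f : (Fin n → ZMod p) → ZMod p) : (Fin n → ZMod p) → ZMod p :=
  fun x => f (x + y) - f x

theorem translate_mem_degreeLE (y : Fin n → ZMod p) {d : ℕ} {f : (Fin n → ZMod p) → ZMod p}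
    (hf : f ∈ degreeLE p n d) : (fun x => f (x + y)) ∈ degreeLE p n d :=
  comp_mem_degreeLE (φ := fun x => x + y)
    (fun i => add_mem (coord_mem_degreeLE i) (const_mem_degreeLE 1 (y i))) hf

theorem diff_eq_zero (y : Fin n → ZMod p) {f : (Fin n → ZMod p) → ZMod p}
    (hf : f ∈ degreeLE p n 0) : diff y f = 0 := by
  obtain ⟨c, rfl⟩ := exists_const_of_mem_degreeLE_zero hf
  ext x
  simp [diff]

theorem diff_mem_degreeLE (y : Fin n → ZMod p) {d : ℕ} {f : (Fin n → ZMod p) → ZMod p}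
    (hf : f ∈ degreeLE p n (d + 1)) : diff y f ∈ degreeLE p n d := by
  let D : ((Fin n → ZMod p) → ZMod p) →ₗ[ZMod p] (Fin n → ZMod p) → ZMod p :=
    LinearMap.funLeft (ZMod p) (ZMod p) (fun x => x + y) - LinearMap.id
  -- The value at `0` is a dummy; it shifts the index so that the induction lowers the degree by
  -- one.
  let S : ℕ → Submodule (ZMod p) ((Fin n → ZMod p) → ZMod p) := fun d =>
    match d with
    | 0 => ⊤
    | d + 1 => (degreeLE p n d).comap D
  refine degreeLE_le_of_mul_coord (S := S) (fun d c => ?_) ?_ (d + 1) hf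
  · cases d with
    | zero => trivial
    | succ d =>
      change diff y (fun _ => c) ∈ degreeLE p n d
      rw [diff_eq_zero y (const_mem_degreeLE 0 c)]
      exact zero_mem _
  · intro d i g hg hgS
    change diff y ((fun x => x i) * g) ∈ degreeLE p n d
    have : diff y ((fun x => x i) * g) =
        (fun x => x i) * diff y g + y i • fun x => g (x + y) := by
      ext x
      simp only [diff, Pi.mul_apply, Pi.add_apply, Pi.smul_apply, smul_eq_mul]
      ring
    rw [this]
    refine add_mem ?_ (smul_mem _ _ (translate_mem_degreeLE y hg))
    cases d with
    | zero =>
      rw [diff_eq_zero y hg, mul_zero]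
      exact zero_mem _
    | succ d =>
      rw [add_comm d]
      exact mul_mem_degreeLE (coord_mem_degreeLE i) hgS

/-- The second difference of `f` at the origin. -/
def d2 (f : (Fin n → ZMod p) → ZMod p) (x y : Fin n → ZMod p) : ZMod p :=
  f (x + y) - f x - f y + f 0

/-- The third difference of `f` at the origin. -/
def d3 (f : (Fin n → ZMod p) → ZMod p) (x y z : Fin n → ZMod p) : ZMod p :=
  f (x + y + z) - f (x + y) - f (x + z) - f (y + z) + f x + f y + f z - f 0

theorem d3_swap₁₂ (f : (Fin n → ZMod p) → ZMod p) (x y z : Fin n → ZMod p) :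
    d3 f x y z = d3 f y x z := by
  simp only [d3, add_comm y x]
  ring

theorem d3_swap₂₃ (f : (Fin n → ZMod p) → ZMod p) (x y z : Fin n → ZMod p) :
    d3 f x y z = d3 f x z y := by
  simp only [d3, add_comm z y, add_right_comm x z y]
  ring

theorem d2_diff (f : (Fin n → ZMod p) → ZMod p) (x y z : Fin n → ZMod p) :
    d2 (diff x f) y z = d3 f x y z := by
  simp only [d2, d3, diff, zero_add]
  rw [show y + z + x = x + y + z by abel, add_comm y x, add_comm z x]
  ring

theorem d3_eq_zero {f : (Fin n → ZMod p) → ZMod p} (hf : f ∈ degreeLE p n 2)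
    (x y z : Fin n → ZMod p) : d3 f x y z = 0 := by
  have h := congrFun (diff_eq_zero z (diff_mem_degreeLE y (diff_mem_degreeLE x hf))) 0
  simp only [diff, zero_add, Pi.zero_apply] at h
  rw [show z + y + x = x + y + z by abel, add_comm y x, add_comm z x, add_comm z y] at h
  rw [d3, ← h]
  ring

theorem d3_add_right {f : (Fin n → ZMod p) → ZMod p} (hf : f ∈ degreeLE p n 3)
    (x y z z' : Fin n → ZMod p) : d3 f x y (z + z') = d3 f x y z + d3 f x y z' := by
  have h := d3_eq_zero (diff_mem_degreeLE x hf) y z z'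
  simp only [d3, diff, zero_add] at h ⊢
  rw [show y + z + z' + x = x + y + (z + z') by abel, show y + z + x = x + y + z by abel,
    show y + z' + x = x + y + z' by abel, show z + z' + x = x + (z + z') by abel,
    show y + z + z' = y + (z + z') by abel, add_comm y x, add_comm z x, add_comm z' x] at h
  linear_combination h

/-- A Leibniz rule: the two sides differ by `(φ x + φ y + φ z) * d3 Q x y z`, which is zero for
quadratic `Q`. -/
theorem d3_linear_mul (φ : (Fin n → ZMod p) →ₗ[ZMod p] ZMod p) {Q : (Fin n → ZMod p) → ZMod p}
    (hQ : Q ∈ degreeLE p n 2) (x y z : Fin n → ZMod p) :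
    d3 (⇑φ * Q) x y z = φ x * d2 Q y z + φ y * d2 Q x z + φ z * d2 Q x y := by
  have h := d3_eq_zero hQ x y z
  simp only [d3, d2, Pi.mul_apply, map_add, map_zero] at h ⊢
  linear_combination (φ x + φ y + φ z) * h

/-- An additive map between vector spaces over `ZMod p` is linear. -/
def linearOfAdd {X Y : Type*} [AddCommGroup X] [Module (ZMod p) X] [AddCommGroup Y]
    [Module (ZMod p) Y] (g : X → Y) (h : ∀ x y, g (x + y) = g x + g y) : X →ₗ[ZMod p] Y :=
  (AddMonoidHom.mk' g h).toZModLinearMap p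

@[simp]
theorem linearOfAdd_apply {X Y : Type*} [AddCommGroup X] [Module (ZMod p) X] [AddCommGroup Y]
    [Module (ZMod p) Y] (g : X → Y) (h : ∀ x y, g (x + y) = g x + g y) (x : X) :
    linearOfAdd (p := p) g h x = g x := rfl

theorem exists_bilinear_d2 {f : (Fin n → ZMod p) → ZMod p} (hf : ∀ x y z, d3 f x y z = 0) :
    ∃ B : (Fin n → ZMod p) →ₗ[ZMod p] (Fin n → ZMod p) →ₗ[ZMod p] ZMod p,
      ∀ x y, B x y = d2 f x y := by
  have h1 : ∀ x y z, d2 f x (y + z) = d2 f x y + d2 f x z := by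
    intro x y z
    have := hf x y z
    simp only [d3, d2] at this ⊢
    rw [← add_assoc]
    linear_combination this
  have hsymm : ∀ x y, d2 f x y = d2 f y x := by
    intro x y
    simp only [d2, add_comm y x]
    ring
  refine ⟨linearOfAdd (fun x => linearOfAdd (d2 f x) (h1 x)) fun x y => ?_, fun x y => rfl⟩
  refine LinearMap.ext fun z => ?_
  simp only [linearOfAdd_apply, LinearMap.add_apply]
  rw [hsymm, h1, hsymm z, hsymm z]

theorem eq_zero_or_one_of_zmod_two : ∀ a : ZMod 2, a = 0 ∨ a = 1 := by decide

/-- A function whose third differences at the origin vanish is quadratic. -/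
theorem mem_degreeLE_two_of_d3_eq_zero [Fact p.Prime] {f : (Fin n → ZMod p) → ZMod p}
    (hf : ∀ x y z, d3 f x y z = 0) : f ∈ degreeLE p n 2 := by
  obtain ⟨B, hB⟩ := exists_bilinear_d2 hf
  have hc := const_mem_degreeLE (n := n) 2 (f 0)
  by_cases hp : p = 2
  -- Without division by two, `f - f 0` is a quadratic form over `ZMod 2`, and every such form is
  -- the diagonal of some bilinear form, not necessarily symmetric.
  · subst hp
    let Q : QuadraticForm (ZMod 2) (Fin n → ZMod 2) :=
      { toFun := fun x => f x - f 0
        toFun_smul := fun a x => by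
          obtain rfl | rfl : a = 0 ∨ a = 1 := eq_zero_or_one_of_zmod_two a
          · simp
          · simp
        exists_companion' := ⟨B, fun x y => by
          rw [hB, d2]
          ring⟩ }
    obtain ⟨A, hA⟩ := LinearMap.BilinMap.toQuadraticMap_surjective Q
    have hQ : ∀ x, A x x = f x - f 0 := fun x => DFunLike.congr_fun hA x
    have : f = (fun x => A x x) + fun _ => f 0 := by
      ext x
      simp [hQ]
    rw [this]
    exact add_mem (bilinear_mem_degreeLE A) hc
  · have h2 : (2 : ZMod p) ≠ 0 := by
      intro h
      have h' : ((2 : ℕ) : ZMod p) = 0 := by exact_mod_cast h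
      rw [ZMod.natCast_eq_zero_iff] at h'
      exact hp ((Nat.prime_dvd_prime_iff_eq Fact.out Nat.prime_two).1 h')
    have hsymm : ∀ x y, B x y = B y x := by
      intro x y
      rw [hB, hB, d2, d2, add_comm y x]
      ring
    -- For odd `p`, removing half the diagonal of `B` leaves an additive function.
    let h : (Fin n → ZMod p) →ₗ[ZMod p] ZMod p :=
      linearOfAdd (fun x => f x - f 0 - 2⁻¹ * B x x) fun x y => by
        have h3 := hB x y
        rw [d2] at h3
        simp only [map_add, LinearMap.add_apply, hsymm y x]
        field_simp
        linear_combination (-2) * h3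
    have : f = (fun x => ((2 : ZMod p)⁻¹ • B) x x) + ⇑h + fun _ => f 0 := by
      ext x
      simp [h]
    rw [this]
    exact add_mem (add_mem (bilinear_mem_degreeLE _)
      (degreeLE_mono (by omega) (linear_mem_degreeLE h))) hc

/-- Induction on the degree through `x_i g - φ_i (g ∘ φ) = (x_i - φ_i) g + φ_i (g - g ∘ φ)`, where
`x_i - φ_i` is a combination of the `l j`. -/
theorem exists_sub_comp_eq_sum {t : ℕ} {φ : (Fin n → ZMod p) →ₗ[ZMod p] Fin n → ZMod p}
    (l : Fin t → (Fin n → ZMod p) →ₗ[ZMod p] ZMod p) (e : Fin t → Fin n → ZMod p)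
    (hφ : ∀ x, x - φ x = ∑ j, l j x • e j) {d : ℕ} {f : (Fin n → ZMod p) → ZMod p}
    (hf : f ∈ degreeLE p n (d + 1)) :
    ∃ q : Fin t → (Fin n → ZMod p) → ZMod p, (∀ j, q j ∈ degreeLE p n d) ∧
      f - f ∘ φ = ∑ j, ⇑(l j) * q j := by
  let I : ℕ → Submodule (ZMod p) ((Fin n → ZMod p) → ZMod p) := fun d =>
    { carrier := {f | ∃ q : Fin t → (Fin n → ZMod p) → ZMod p,
        (∀ j, q j ∈ degreeLE p n d) ∧ f = ∑ j, ⇑(l j) * q j}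
      add_mem' := by
        rintro _ _ ⟨q, hq, rfl⟩ ⟨q', hq', rfl⟩
        exact ⟨q + q', fun j => add_mem (hq j) (hq' j), by
          simp [mul_add, Finset.sum_add_distrib]⟩
      zero_mem' := ⟨0, fun j => zero_mem _, by simp⟩
      smul_mem' := by
        rintro c _ ⟨q, hq, rfl⟩
        exact ⟨c • q, fun j => smul_mem _ c (hq j), by simp [Finset.smul_sum]⟩ }
  let D : ((Fin n → ZMod p) → ZMod p) →ₗ[ZMod p] (Fin n → ZMod p) → ZMod p :=
    LinearMap.id - LinearMap.funLeft (ZMod p) (ZMod p) φ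
  let S : ℕ → Submodule (ZMod p) ((Fin n → ZMod p) → ZMod p) := fun d =>
    match d with
    | 0 => ⊤
    | d + 1 => (I d).comap D
  have hconst : ∀ c : ZMod p, D (fun _ => c) = 0 := fun c => sub_self _
  refine degreeLE_le_of_mul_coord (S := S) (fun d c => ?_) ?_ (d + 1) hf
  · cases d with
    | zero => trivial
    | succ d =>
      change D (fun _ => c) ∈ I d
      rw [hconst]
      exact zero_mem _
  · intro d i g hg hgS
    change D ((fun x => x i) * g) ∈ I d
    have h1 : D ((fun x => x i) * g) =
        (∑ j, ⇑(l j) * (e j i • g)) + (fun x => φ x i) * D g := by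
      ext x
      have h2 := congrFun (hφ x) i
      simp only [Pi.sub_apply, Finset.sum_apply, Pi.smul_apply, smul_eq_mul] at h2
      have h3 : (∑ j, ⇑(l j) * (e j i • g)) x = (x i - φ x i) * g x := by
        rw [h2, Finset.sum_mul]
        simp [mul_assoc, mul_left_comm]
      rw [Pi.add_apply, h3]
      simp only [D, LinearMap.sub_apply, LinearMap.id_apply, Pi.sub_apply, Pi.mul_apply,
        LinearMap.funLeft_apply]
      ring
    rw [h1]
    refine add_mem ⟨_, fun j => smul_mem _ _ hg, rfl⟩ ?_
    cases d with
    | zero =>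
      obtain ⟨c, rfl⟩ := exists_const_of_mem_degreeLE_zero hg
      rw [hconst, mul_zero]
      exact zero_mem _
    | succ d =>
      obtain ⟨q, hq, hDq⟩ : D g ∈ I d := hgS
      refine ⟨fun j => (fun x => φ x i) * q j, fun j => ?_, ?_⟩
      · rw [add_comm d]
        exact mul_mem_degreeLE (linear_mem_degreeLE (LinearMap.proj i ∘ₗ φ)) (hq j)
      · rw [hDq, Finset.mul_sum]
        exact Finset.sum_congr rfl fun j _ => by ring

/-- A cubic function whose third differences vanish on a subspace `U` lies, up to a quadratic
function, in the ideal generated by the linear forms vanishing on `U`. -/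
theorem exists_rep_of_d3_eq_zero_on [Fact p.Prime]
    (U : Submodule (ZMod p) (Fin n → ZMod p)) :
    ∃ l : Fin (codim U) → (Fin n → ZMod p) → ZMod p, (∀ j, l j ∈ degreeLE p n 1) ∧
      ∀ f ∈ degreeLE p n 3, (∀ x ∈ U, ∀ y ∈ U, ∀ z ∈ U, d3 f x y z = 0) →
        ∃ (q : Fin (codim U) → (Fin n → ZMod p) → ZMod p) (q₀ : (Fin n → ZMod p) → ZMod p),
          (∀ j, q j ∈ degreeLE p n 2) ∧ q₀ ∈ degreeLE p n 2 ∧ f = ∑ j, l j * q j + q₀ := by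
  obtain ⟨π, hπ⟩ := exists_projection U
  have hker : finrank (ZMod p) (LinearMap.ker π) = codim U := by
    have h1 := LinearMap.finrank_range_add_finrank_ker π
    have h2 : LinearMap.range π = ⊤ := LinearMap.range_eq_top.2 fun x => ⟨x, hπ x⟩
    have h3 := codim_add_finrank U
    rw [h2, finrank_top] at h1
    omega
  let b := (finBasis (ZMod p) (LinearMap.ker π)).reindex (finCongr hker)
  let φ := U.subtype ∘ₗ π
  obtain ⟨κ, hκ⟩ := exists_projection (LinearMap.ker π)
  let l : Fin (codim U) → (Fin n → ZMod p) →ₗ[ZMod p] ZMod p := fun j =>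
    b.coord j ∘ₗ κ ∘ₗ (LinearMap.id - φ)
  have hl : ∀ x, x - φ x = ∑ j, l j x • (b j : Fin n → ZMod p) := by
    intro x
    have hx : x - φ x ∈ LinearMap.ker π := by
      rw [LinearMap.mem_ker, map_sub]
      exact sub_eq_zero.2 (hπ (π x)).symm
    have h1 : κ (x - φ x) = ⟨x - φ x, hx⟩ := hκ ⟨_, hx⟩
    have h2 := congrArg Subtype.val (b.sum_repr (κ (x - φ x)))
    simp only [Submodule.coe_sum, Submodule.coe_smul] at h2
    rw [h1] at h2
    refine h2.symm.trans (Finset.sum_congr rfl fun j _ => ?_)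
    rw [← h1]
    rfl
  refine ⟨fun j => l j, fun j => linear_mem_degreeLE (l j), fun f hf hU => ?_⟩
  -- Split `f` as `(f - f ∘ φ) + f ∘ φ`, with `φ` a projection onto `U`: the first part lies in the
  -- ideal of the `l j`, and the third differences of the second vanish everywhere.
  obtain ⟨q, hq, hfq⟩ := exists_sub_comp_eq_sum l (fun j => (b j : Fin n → ZMod p)) hl hf
  refine ⟨q, f ∘ φ, hq, mem_degreeLE_two_of_d3_eq_zero fun x y z => ?_, ?_⟩
  · have := hU (φ x) (π x).2 (φ y) (π y).2 (φ z) (π z).2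
    simpa [d3] using this
  · rw [← hfq, sub_add_cancel]

end Degree

/-! ### From cubic functions to trilinear forms and back. -/

section Cubic

variable {p n : ℕ}

theorem exists_hasCubicRep_le {f : (Fin n → ZMod p) → ZMod p} {r : ℕ} (hf : HasDegreeLE 3 f)
    (hr : rank₃ f ≤ r) : ∃ s ≤ r, HasCubicRep s f :=
  ⟨rank₃ f, hr, Nat.sInf_mem (exists_hasCubicRep hf)⟩

/-- The third differences of a cubic of rank at most `s` vanish on a subspace of codimension at
most `s`. -/
theorem exists_codim_le_d3_eq_zero [Fact p.Prime] {f : (Fin n → ZMod p) → ZMod p} {s : ℕ}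
    (hf : HasCubicRep s f) : ∃ K : Submodule (ZMod p) (Fin n → ZMod p), codim K ≤ s ∧
      ∀ x ∈ K, ∀ y ∈ K, ∀ z ∈ K, d3 f x y z = 0 := by
  obtain ⟨l, q, q₀, hl, hq, hq₀, rfl⟩ := hf
  have hdiff : ∀ i x y, l i (x + y) = l i x + l i y - l i 0 := by
    intro i x y
    have := congrFun (diff_eq_zero y (diff_mem_degreeLE x (hl i))) 0
    simp only [diff, zero_add, Pi.zero_apply, add_comm y x] at this
    linear_combination this
  obtain ⟨K, hK, hK0⟩ := exists_codim_le_of_functionals fun i =>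
    linearOfAdd (p := p) (fun x => l i x - l i 0) fun x y => by
      rw [hdiff]
      ring
  refine ⟨K, hK, fun x hx y hy z hz => ?_⟩
  -- The `l i` may have constant terms; on `K` they are constant, so `f` agrees there with a
  -- quadratic function.
  have hl0 : ∀ i, ∀ v ∈ K, l i v = l i 0 := fun i v hv => sub_eq_zero.1 (hK0 v hv i)
  have hterm : ∀ i, d3 (l i * q i) x y z = 0 := by
    intro i
    have h := d3_eq_zero (hq i) x y z
    simp only [d3, Pi.mul_apply] at h ⊢
    rw [hl0 i _ (add_mem (add_mem hx hy) hz), hl0 i _ (add_mem hx hy), hl0 i _ (add_mem hx hz),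
      hl0 i _ (add_mem hy hz), hl0 i x hx, hl0 i y hy, hl0 i z hz]
    linear_combination l i 0 * h
  have hsum : d3 (∑ i, l i * q i + q₀) x y z = ∑ i, d3 (l i * q i) x y z + d3 q₀ x y z := by
    simp only [d3, Pi.add_apply, Finset.sum_apply, Finset.sum_add_distrib,
      Finset.sum_sub_distrib]
    ring
  rw [hsum, d3_eq_zero hq₀, add_zero]
  exact Finset.sum_eq_zero fun i _ => hterm i

set_option maxSynthPendingDepth 6 in
/-- The third differences at the origin as a linear family of trilinear forms. -/
theorem exists_trilinear_d3 {M : Submodule (ZMod p) ((Fin n → ZMod p) → ZMod p)}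
    (hM : M ≤ degreeLE p n 3) :
    ∃ Φ : M →ₗ[ZMod p] (Fin n → ZMod p) →ₗ[ZMod p] (Fin n → ZMod p) →ₗ[ZMod p]
      (Fin n → ZMod p) →ₗ[ZMod p] ZMod p, ∀ f x y z, Φ f x y z = d3 f.1 x y z := by
  have h3 : ∀ (f : M) x y z z', d3 f.1 x y (z + z') = d3 f.1 x y z + d3 f.1 x y z' :=
    fun f => d3_add_right (hM f.2)
  have h2 : ∀ (f : M) x y y' z, d3 f.1 x (y + y') z = d3 f.1 x y z + d3 f.1 x y' z := by
    intro f x y y' z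
    rw [d3_swap₂₃, h3, d3_swap₂₃ _ x z y, d3_swap₂₃ _ x z y']
  have h1 : ∀ (f : M) x x' y z, d3 f.1 (x + x') y z = d3 f.1 x y z + d3 f.1 x' y z := by
    intro f x x' y z
    rw [d3_swap₁₂, h2, d3_swap₁₂ _ y x, d3_swap₁₂ _ y x']
  refine ⟨linearOfAdd (fun f => linearOfAdd (fun x => linearOfAdd (fun y =>
    linearOfAdd (d3 f.1 x y) (h3 f x y)) ?_) ?_) ?_, fun f x y z => rfl⟩
  · intro y y'
    exact LinearMap.ext fun z => h2 f x y y' z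
  · intro x x'
    exact LinearMap.ext₂ fun y z => h1 f x x' y z
  · intro f g
    refine LinearMap.ext fun x => LinearMap.ext₂ fun y z => ?_
    simp only [linearOfAdd_apply, LinearMap.add_apply, d3, Submodule.coe_add, Pi.add_apply]
    ring

/-- The generator `Φ f x` is the second difference of the derivative of `f` in direction `x`, and
`d2` is linear. This avoids halving `w y y`, which fails for `p = 2`. -/
theorem exists_quadratic_of_mem_span {M : Submodule (ZMod p) ((Fin n → ZMod p) → ZMod p)}
    (hM : M ≤ degreeLE p n 3)
    {Φ : M →ₗ[ZMod p] (Fin n → ZMod p) →ₗ[ZMod p] (Fin n → ZMod p) →ₗ[ZMod p]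
      (Fin n → ZMod p) →ₗ[ZMod p] ZMod p} (hΦ : ∀ f x y z, Φ f x y z = d3 f.1 x y z)
    {w : (Fin n → ZMod p) →ₗ[ZMod p] (Fin n → ZMod p) →ₗ[ZMod p] ZMod p}
    (hw : w ∈ span (ZMod p) {β | ∃ f x, β = Φ f x}) :
    ∃ Q ∈ degreeLE p n 2, ∀ y z, d2 Q y z = w y z := by
  induction hw using span_induction with
  | mem w hw =>
    obtain ⟨f, x, rfl⟩ := hw
    exact ⟨diff x f.1, diff_mem_degreeLE x (hM f.2), fun y z => by rw [d2_diff, hΦ]⟩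
  | zero => exact ⟨0, zero_mem _, fun y z => by simp [d2]⟩
  | add w w' _ _ ih ih' =>
    obtain ⟨Q, hQ, h⟩ := ih
    obtain ⟨Q', hQ', h'⟩ := ih'
    refine ⟨Q + Q', add_mem hQ hQ', fun y z => ?_⟩
    rw [LinearMap.add_apply, LinearMap.add_apply, ← h, ← h']
    simp only [d2, Pi.add_apply]
    ring
  | smul c w _ ih =>
    obtain ⟨Q, hQ, h⟩ := ih
    refine ⟨c • Q, smul_mem _ c hQ, fun y z => ?_⟩
    rw [LinearMap.smul_apply, LinearMap.smul_apply, ← h]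
    simp only [d2, Pi.smul_apply, smul_eq_mul]
    ring

theorem d3_sub_sum {t : ℕ} (f : (Fin n → ZMod p) → ZMod p)
    (g : Fin t → (Fin n → ZMod p) → ZMod p) (x y z : Fin n → ZMod p) :
    d3 (f - ∑ i, g i) x y z = d3 f x y z - ∑ i, d3 (g i) x y z := by
  simp only [d3, Pi.sub_apply, Finset.sum_apply, Finset.sum_add_distrib, Finset.sum_sub_distrib]
  ring

end Cubic

end CubicSpace

/-! ### Assembly of the theorem. -/

open CubicSpace in
theorem mainTheorem6 :
    ∃ C : ℕ, ∀ (p : ℕ) [Fact p.Prime] (n r : ℕ)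
      (M : Submodule (ZMod p) ((Fin n → ZMod p) → ZMod p)),
      (∀ f ∈ M, HasDegreeLE 3 f) → (∀ f ∈ M, rank₃ f ≤ r) →
      ∃ t₁ t₂ : ℕ, t₁ ≤ r ∧ t₂ ≤ 2 ^ (C * r) ∧
        ∃ (Q : Fin t₁ → (Fin n → ZMod p) → ZMod p) (l : Fin t₂ → (Fin n → ZMod p) → ZMod p),
          (∀ i, HasDegreeLE 2 (Q i)) ∧ (∀ j, HasDegreeLE 1 (l j)) ∧
          ∀ f ∈ M, ∃ (lf : Fin t₁ → (Fin n → ZMod p) → ZMod p)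
            (Qf : Fin t₂ → (Fin n → ZMod p) → ZMod p) (Q₀f : (Fin n → ZMod p) → ZMod p),
            (∀ i, HasDegreeLE 1 (lf i)) ∧ (∀ j, HasDegreeLE 2 (Qf j)) ∧ HasDegreeLE 2 Q₀f ∧
            f = ∑ i, lf i * Q i + ∑ j, l j * Qf j + Q₀f := by
  refine ⟨30, fun p _ n r M hM hr => ?_⟩
  -- The bound `2 ^ (30 * r)` was established only for `r ≥ 1`; for `r = 0` every `f` is already
  -- quadratic.
  rcases Nat.eq_zero_or_pos r with rfl | hpos
  · refine ⟨0, 0, le_rfl, Nat.zero_le _, Fin.elim0, Fin.elim0, fun i => i.elim0,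
      fun j => j.elim0, fun f hf => ?_⟩
    obtain ⟨s, hs, hrep⟩ := exists_hasCubicRep_le (hM f hf) (hr f hf)
    obtain rfl := Nat.le_zero.1 hs
    obtain ⟨l, q, q₀, -, -, hq₀, rfl⟩ := hrep
    exact ⟨Fin.elim0, Fin.elim0, q₀, fun i => i.elim0, fun j => j.elim0, hq₀, by simp⟩
  have hM' : M ≤ degreeLE p n 3 := hM
  obtain ⟨Φ, hΦ⟩ := exists_trilinear_d3 hM'
  obtain ⟨U, t, w, lin, ht, hU, hw, hstruct⟩ := exists_trilinear_structure (Φ := Φ)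
    (fun f x y z => by rw [hΦ, hΦ, d3_swap₁₂]) (fun f x y z => by rw [hΦ, hΦ, d3_swap₂₃]) hpos
    (fun f => by
      obtain ⟨s, hs, hrep⟩ := exists_hasCubicRep_le (hM f.1 f.2) (hr f.1 f.2)
      obtain ⟨K, hK, hK0⟩ := exists_codim_le_d3_eq_zero hrep
      exact ⟨K, hK.trans hs, fun x hx y hy z hz => by rw [hΦ, hK0 x hx y hy z hz]⟩)
  choose Q hQ hQw using fun i => exists_quadratic_of_mem_span hM' hΦ (hw i)
  obtain ⟨l, hl, hrep⟩ := exists_rep_of_d3_eq_zero_on U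
  refine ⟨t, codim U, ht, hU, Q, l, hQ, hl, fun f hf => ?_⟩
  have hlf : ∀ i, ⇑(lin i ⟨f, hf⟩) ∈ degreeLE p n 1 := fun i => linear_mem_degreeLE _
  obtain ⟨q, q₀, hq, hq₀, hg⟩ := hrep (f - ∑ i, ⇑(lin i ⟨f, hf⟩) * Q i)
    (sub_mem (hM' hf) (sum_mem fun i _ => mul_mem_degreeLE (hlf i) (hQ i)))
    fun x hx y hy z hz => by
      have h := hstruct ⟨f, hf⟩ x hx y hy z hz
      rw [hΦ] at h
      rw [d3_sub_sum, h, sub_eq_zero]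
      refine Finset.sum_congr rfl fun i _ => ?_
      rw [d3_linear_mul _ (hQ i), hQw, hQw, hQw]
  refine ⟨fun i => lin i ⟨f, hf⟩, q, q₀, hlf, hq, hq₀, ?_⟩
  rw [add_assoc, ← hg, add_sub_cancel]
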